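/- Let $n\ge 2$ and work over $\mathbb C$. Let $x^i_j$ ($1\le i,j\le n$, row $i$, column $j$) be the coordinates on $Mat_n$. For $r\ge 0$ let $\hat\sigma_r\subset Mat_n$ be the set of matrices of rank at most $r$. The $r$-rigidity of $M$ is the least $s$ such that $M=A+B$ with $A\in\hat\sigma_r$ and $B$ having exactly $s$ nonzero entries, and $\hat{\mathcal R}[n,r,s]$ is the Zariski closure of the set of matrices of $r$-rigidity at most $s$. For a set $S$ of entries let $L^S\subset Mat_n$ be the span of the matrix units at the positions in $S$, and let $J(\sigma_r,L^S)$ denote the (affine cone over the) join of $\sigma_r$ and $L^S$, i.e. the Zariski closure of the union of the linear spans $\langle A,B\rangle$, $A\in\hat\sigma_r$, $B\in L^S$. Varieties in $\mathbb P(Mat_n)$ are identified with their affine cones. The codimension of a variety is the least $c$ such that every linear $\mathbb P^c$ meets it; a hypersurface is a variety of codimension $1$; its equation is the generator (unique up to a nonzero scalar) of its ideal, and its degree is the degree of its equation. Let $M^I_J$ be the minor with rows $I$ and columns $J$ (both in increasing order), and let $\Delta^I_J$ be the minor obtained by deleting the rows in $I$ and the columns in $J$. Consider $r=n-2$ and $s=3$.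 For sets $S$ of three entries, say that $S$ is of type 1 if its entries lie in three distinct rows and three distinct columns, collinear if its entries all lie in one row or all lie in one column, and of type 2 otherwise (i.e. $S$ is not collinear, but two of its entries share a row or a column). The irreducible components of $\hat{\mathcal R}[n,n-2,3]$ are exactly the varieties $J(\sigma_{n-2},L^S)$ with $S$ of type 1 or of type 2. The varieties of one type are all isomorphic to each other by linear automorphisms of $Mat_n$, and no such automorphism carries a variety of type 1 to a variety of type 2. Moreover: 1. If $S$ is of type 1, then $J(\sigma_{n-2},L^S)$ is a hypersurface of degree $2n-3$, and for a suitable labelling $S=\{x^{i_1}_{j_1},x^{i_2}_{j_2},x^{i_3}_{j_3}\}$ its equation is $$\Delta^{i_3}_{j_2}\Delta^{i_1i_2}_{j_1j_3}-\Delta^{i_2}_{j_3}\Delta^{i_1i_3}_{j_1j_2}.$$ For an arbitrary labelling of $S$ the equation is $$\Delta^{i_3}_{j_2}\Delta^{i_1i_2}_{j_1j_3}-\varepsilon\,\Delta^{i_2}_{j_3}\Delta^{i_1i_3}_{j_1j_2},\qquad \varepsilon=(-1)^{\#\{k\,:\,i_k<i_1\}+\#\{k\,:\,j_k<j_1\}}.$$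 There are exactly $6\binom n3^2$ such components, and they are of maximal degree: every irreducible component of $\hat{\mathcal R}[n,n-2,3]$ has degree at most $2n-3$. 2. If $S$ is of type 2, then there is exactly one minor $M^I_J$ of size $n-1$ whose submatrix contains no element of $S$; $J(\sigma_{n-2},L^S)$ is a hypersurface of degree $n-1$, and its equation is this minor. There are exactly $n^2$ such components. 3. If $S$ is a collinear set of three entries, then $J(\sigma_{n-2},L^S)$ is not a hypersurface. -/

import Mathlib

/-! Matrix rigidity, border rigidity and joins of determinantal varieties with coordinate spaces,
over the complex numbers. Projective varieties in `ℙ(Mat_n)` are represented by their affine cones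
in `Mat_n`. -/

noncomputable section

namespace Rigidity

/-- The space of `n × n` complex matrices. -/
abbrev Mat (n : ℕ) : Type := Matrix (Fin n) (Fin n) ℂ

/-- The polynomial ring in the coordinates `x^i_j`; the variable `(i, j)` is the entry in row `i` and
column `j`. -/
abbrev Poly (n : ℕ) : Type := MvPolynomial (Fin n × Fin n) ℂ

/-- The value of a polynomial at a matrix. -/
def evalAt {n : ℕ} (M : Mat n) (P : Poly n) : ℂ :=
  MvPolynomial.eval (fun p : Fin n × Fin n => M p.1 p.2) P

/-- The ideal of all polynomials vanishing on a set of matrices. -/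
def idealOf {n : ℕ} (X : Set (Mat n)) : Ideal (Poly n) :=
  MvPolynomial.vanishingIdeal ℂ ((fun (M : Mat n) (p : Fin n × Fin n) => M p.1 p.2) '' X)

/-- The Zariski closure: the common zeros of all polynomials that vanish on `X`. -/
def zariskiClosure {n : ℕ} (X : Set (Mat n)) : Set (Mat n) :=
  {M | ∀ P ∈ idealOf X, evalAt M P = 0}

def IsZariskiClosed {n : ℕ} (X : Set (Mat n)) : Prop :=
  zariskiClosure X = X

/-- An irreducible Zariski closed set. -/
def IsIrredVariety {n : ℕ} (X : Set (Mat n)) : Prop :=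
  IsZariskiClosed X ∧ X.Nonempty ∧
    ∀ Y Z : Set (Mat n), IsZariskiClosed Y → IsZariskiClosed Z → X ⊆ Y ∪ Z → X ⊆ Y ∨ X ⊆ Z

/-- `X` is an irreducible component of `V`: a maximal irreducible closed subset of `V`. -/
def IsComponent {n : ℕ} (V X : Set (Mat n)) : Prop :=
  Maximal (fun Y : Set (Mat n) => IsIrredVariety Y ∧ Y ⊆ V) X

/-- The codimension of the projective variety with affine cone `X`: the least `c` such that every
linear `ℙ^c` (every linear subspace of dimension `c + 1`) meets the variety. -/
def codim {n : ℕ} (X : Set (Mat n)) : ℕ :=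
  sInf {c : ℕ | ∀ W : Submodule ℂ (Mat n), Module.finrank ℂ W = c + 1 →
    ∃ M ∈ W, M ≠ 0 ∧ M ∈ X}

/-- A hypersurface is a variety of codimension one. -/
def IsHypersurface {n : ℕ} (X : Set (Mat n)) : Prop :=
  IsZariskiClosed X ∧ codim X = 1

/-- `P` is the equation of `X` (unique up to a nonzero scalar): it generates the ideal of `X`. -/
def HasEquation {n : ℕ} (X : Set (Mat n)) (P : Poly n) : Prop :=
  idealOf X = Ideal.span {P}

/-- A hypersurface has degree `d` if its equation has degree `d`. -/
def IsHypersurfaceOfDegree {n : ℕ} (X : Set (Mat n)) (d : ℕ) : Prop :=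
  IsHypersurface X ∧ ∃ P : Poly n, HasEquation X P ∧ P.totalDegree = d

/-- Two cones in `Mat_n` are linearly isomorphic (their projectivizations are projectively
isomorphic) if an invertible linear map of `Mat_n` carries one onto the other. -/
def LinIso {n : ℕ} (X Y : Set (Mat n)) : Prop :=
  ∃ g : Mat n ≃ₗ[ℂ] Mat n, g '' X = Y

/-- The matrices of rank at most `r`. -/
def rankLE (n r : ℕ) : Set (Mat n) :=
  {A | A.rank ≤ r}

/-- The `r`-rigidity of `M`: the least `s` such that `M = A + B` with `A` of rank at most `r` and `B`
with exactly `s` nonzero entries. -/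
def rig {n : ℕ} (r : ℕ) (M : Mat n) : ℕ :=
  sInf {s : ℕ | ∃ A ∈ rankLE n r, ∃ B : Mat n, M = A + B ∧
    Set.ncard {p : Fin n × Fin n | B p.1 p.2 ≠ 0} = s}

/-- The variety of matrices of `r`-border rigidity at most `s`. -/
def borderRig (n r s : ℕ) : Set (Mat n) :=
  zariskiClosure {M : Mat n | rig r M ≤ s}

/-- The span of the matrix units at the positions in `S`. -/
def coordSpace {n : ℕ} (S : Finset (Fin n × Fin n)) : Submodule ℂ (Mat n) :=
  Submodule.span ℂ ((fun p : Fin n × Fin n => Matrix.single p.1 p.2 (1 : ℂ)) '' (S : Set (Fin n × Fin n)))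

/-- The (affine cone over the) join of two varieties with affine cones `X` and `Y`: the closure of
the union of the spans of a point of `X` and a point of `Y`. -/
def join {n : ℕ} (X Y : Set (Mat n)) : Set (Mat n) :=
  zariskiClosure {M : Mat n | ∃ A ∈ X, ∃ B ∈ Y, M ∈ Submodule.span ℂ ({A, B} : Set (Mat n))}

/-- The join of the variety of matrices of rank at most `r` with the coordinate space of `S`. -/
def rigJoin {n : ℕ} (r : ℕ) (S : Finset (Fin n × Fin n)) : Set (Mat n) :=
  join (rankLE n r) (coordSpace S : Set (Mat n))

/-- The minor `M^I_J` of the generic matrix, with rows `I` and columns `J` in increasing order. It is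
only used for `I` and `J` of the same size, and set to `0` otherwise. -/
def minor {n : ℕ} (I J : Finset (Fin n)) : Poly n :=
  if h : J.card = I.card then
    ((Matrix.mvPolynomialX (Fin n) (Fin n) ℂ).submatrix
      (I.orderEmbOfFin rfl) (J.orderEmbOfFin h)).det
  else 0

/-- The minor `Δ^I_J` obtained by deleting the rows in `I` and the columns in `J`. -/
def delMinor {n : ℕ} (I J : Finset (Fin n)) : Poly n :=
  minor Iᶜ Jᶜ

/-- No two entries of `S` lie in the same row or in the same column. -/
def Transversal {n : ℕ} (S : Finset (Fin n × Fin n)) : Prop :=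
  ∀ p ∈ S, ∀ q ∈ S, p ≠ q → p.1 ≠ q.1 ∧ p.2 ≠ q.2

/-- All entries of `S` lie in one row, or all lie in one column. -/
def Collinear {n : ℕ} (S : Finset (Fin n × Fin n)) : Prop :=
  (∃ i, ∀ p ∈ S, p.1 = i) ∨ (∃ j, ∀ p ∈ S, p.2 = j)

/-- First type: three entries in distinct rows and distinct columns. -/
def TypeOne {n : ℕ} (S : Finset (Fin n × Fin n)) : Prop :=
  S.card = 3 ∧ Transversal S

/-- Second type: three entries, not all in one row or all in one column, of which two lie in one row
or in one column. -/
def TypeTwo {n : ℕ} (S : Finset (Fin n × Fin n)) : Prop :=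
  S.card = 3 ∧ ¬ Transversal S ∧ ¬ Collinear S

/-- The positions `(i_1, j_1)`, `(i_2, j_2)`, `(i_3, j_3)`; the indices `1, 2, 3` are the elements
`0, 1, 2` of `Fin 3`. -/
def entries {n : ℕ} (i j : Fin 3 → Fin n) : Finset (Fin n × Fin n) :=
  {(i 0, j 0), (i 1, j 1), (i 2, j 2)}

/-- The polynomial
`Δ^{i_3}_{j_2} Δ^{i_1 i_2}_{j_1 j_3} - ε Δ^{i_2}_{j_3} Δ^{i_1 i_3}_{j_1 j_2}`. -/
def twoTermEq {n : ℕ} (ε : ℤ) (i j : Fin 3 → Fin n) : Poly n :=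
  delMinor {i 2} {j 1} * delMinor {i 0, i 1} {j 0, j 2} -
    (ε : Poly n) * (delMinor {i 1} {j 2} * delMinor {i 0, i 2} {j 0, j 1})

/-- `(-1)` to the number of `k` with `i_k < i_1` plus the number of `k` with `j_k < j_1`. -/
def labelSign {n : ℕ} (i j : Fin 3 → Fin n) : ℤ :=
  (-1) ^ ((Finset.univ.filter fun k => i k < i 0).card +
    (Finset.univ.filter fun k => j k < j 0).card)

end Rigidity

end

open Rigidity

/-! Let `M` be invertible with inverse `N`. A matrix `B` makes `M - B` of corank at least two as
soon as `B * N` fixes two independent vectors (`rank_sub_le_of_mul_eq_one`). With `B` supported on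
`S`, this becomes a condition on the few entries of `N` at the positions transposed to `S`.

For transversal `S` the condition is that the 3 by 3 submatrix of `N` becomes a rank one matrix
after a change of its diagonal. Generically this holds exactly when the two cyclic products of its
off-diagonal entries agree. By Jacobi's identity for complementary minors (`cof2_of_mul_eq_one`),
`det ^ 2` times the difference of these products is a polynomial of degree `2 * n - 3`, namely
`signedEq`, which is `twoTermEq` up to sign. Conversely `signedEq` does not involve the variables in
`S` and vanishes on rank at most `n - 2`, hence on the join (`hasEquation_signedEq`).

For `S` of the second type there is exactly one row `i` and column `c` whose union contains `S`. The
cofactor at `(i, c)` does not see `S`, so it vanishes on the join; generically on its zero set, `B`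
is found by solving a 2 by 2 and a 1 by 1 linear system (`hasEquation_adjugate_of_ne`).

These polynomials are irreducible: each has degree one in some variable, and a single permutation
matrix shows that the leading coefficient is prime to the constant term (`irreducible_of_linear`,
`isRelPrime_zeroAt`). Together with generic sufficiency and the Nullstellensatz they therefore
generate the ideals (`hasEquation_of_generic`). So the joins of both types are irreducible
hypersurfaces and none properly contains another. A collinear support lies in a row-column cross, so
its sums lie in a hypersurface of the second type; this gives the components (`isComponent_iff`).

The counts come from reading `S`, or its corner, off the equation: scaling a row shows which rows
occur, and the absent variables of the block locate `S`. For collinear `S` all cofactors of one row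
or column vanish on the join, and a bidiagonal pencil avoids this locus, so the codimension is not
one. -/

noncomputable section

namespace Rigidity

open Matrix

set_option linter.unusedSectionVars false

/-! ### First and second order cofactors and the two-term polynomial. -/

section MatrixAlgebra

variable {ι R : Type*} [Fintype ι] [DecidableEq ι] [CommRing R]

/-- The signed second order cofactor: rows `i`, `i'` are replaced by the unit vectors at
`j`, `j'`. -/
def cof2 (M : Matrix ι ι R) (i i' j j' : ι) : R :=
  ((M.updateRow i (Pi.single j 1)).updateRow i' (Pi.single j' 1)).det

/-- The signed form of the two-term equation of a transversal set. -/
def signedEq (M : Matrix ι ι R) (i j : Fin 3 → ι) : R :=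
  M.adjugate (j 1) (i 2) * cof2 M (i 0) (i 1) (j 0) (j 2) -
    M.adjugate (j 2) (i 1) * cof2 M (i 0) (i 2) (j 0) (j 1)

theorem cof2_eq_adjugate (M : Matrix ι ι R) (i i' j j' : ι) :
    cof2 M i i' j j' = (M.updateRow i (Pi.single j 1)).adjugate j' i' := by
  rw [cof2, adjugate_apply]

theorem map_cof2 {S : Type*} [CommRing S] (f : R →+* S) (M : Matrix ι ι R) (i i' j j' : ι) :
    f (cof2 M i i' j j') = cof2 (M.map f) i i' j j' := by
  rw [cof2, cof2, RingHom.map_det]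
  congr 1
  ext a b
  simp only [RingHom.mapMatrix_apply, map_apply, updateRow_apply, Pi.single_apply]
  split_ifs <;> simp

theorem map_adjugate_apply {S : Type*} [CommRing S] (f : R →+* S) (M : Matrix ι ι R) (i j : ι) :
    f (M.adjugate i j) = (M.map f).adjugate i j := by
  have := congrFun (congrFun (RingHom.map_adjugate f M) i) j
  simpa using this

theorem map_signedEq {S : Type*} [CommRing S] (f : R →+* S) (M : Matrix ι ι R) (i j : Fin 3 → ι) :
    f (signedEq M i j) = signedEq (M.map f) i j := by
  simp only [signedEq, map_sub, map_mul, map_cof2, map_adjugate_apply]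

/-- The modified identity is `1 + U * V` with `U` of width two, so Sylvester's identity reduces the
determinant to size two. -/
theorem det_updateRow_updateRow_one {i i' : ι} (h : i ≠ i') (a b : ι → R) :
    (((1 : Matrix ι ι R).updateRow i a).updateRow i' b).det = a i * b i' - a i' * b i := by
  let U : Matrix ι (Fin 2) R := of fun k l => if k = ![i, i'] l then 1 else 0
  let V : Matrix (Fin 2) ι R := of ![a - Pi.single i 1, b - Pi.single i' 1]
  have hU0 : ∀ k, U k 0 = if k = i then 1 else 0 := fun _ => rfl
  have hU1 : ∀ k, U k 1 = if k = i' then 1 else 0 := fun _ => rfl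
  have hV0 : ∀ k, V 0 k = a k - if k = i then 1 else 0 := fun k => by
    simp [V, Pi.single_apply]
  have hV1 : ∀ k, V 1 k = b k - if k = i' then 1 else 0 := fun k => by
    simp [V, Pi.single_apply]
  have : ((1 : Matrix ι ι R).updateRow i a).updateRow i' b = 1 + U * V := by
    ext x y
    rw [Matrix.add_apply, mul_apply, Fin.sum_univ_two, hU0, hU1, hV0, hV1, one_apply]
    simp only [updateRow_apply, one_apply]
    grind
  rw [this, det_one_add_mul_comm, det_fin_two]
  simp only [Matrix.add_apply, mul_apply, hU0, hU1, hV0, hV1]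
  have e : ∀ (f : ι → R) (k : ι), ∑ x, f x * (if x = k then 1 else 0) = f k := by simp
  rw [e, e, e, e]
  simp [h, h.symm]

theorem adjugate_eq_of_mul_eq_one {M N : Matrix ι ι R} (h : M * N = 1) :
    M.adjugate = M.det • N := by
  rw [← Matrix.mul_one M.adjugate, ← h, ← Matrix.mul_assoc, adjugate_mul, smul_mul, Matrix.one_mul]

/-- Jacobi's identity for complementary minors: multiplying the modified `M` by `N` turns it into
the identity matrix with two rows replaced by rows of `N`. -/
theorem cof2_of_mul_eq_one {M N : Matrix ι ι R} (h : M * N = 1) {i i' : ι} (hi : i ≠ i')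
    (j j' : ι) : cof2 M i i' j j' = M.det * (N j i * N j' i' - N j i' * N j' i) := by
  have h1 : ((M.updateRow i (Pi.single j 1)).updateRow i' (Pi.single j' 1)) * N =
      ((1 : Matrix ι ι R).updateRow i (N j)).updateRow i' (N j') := by
    rw [updateRow_mul, updateRow_mul, h, single_one_vecMul, single_one_vecMul]
    rfl
  have h2 := congrArg det h1
  rw [det_mul, det_updateRow_updateRow_one hi] at h2
  have h3 : M.det * N.det = 1 := by rw [← det_mul, h, det_one]
  rw [cof2, ← h2]
  linear_combination (-((M.updateRow i (Pi.single j 1)).updateRow i' (Pi.single j' 1)).det) * h3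

theorem signedEq_of_mul_eq_one {M N : Matrix ι ι R} (h : M * N = 1) {i : Fin 3 → ι}
    (hi : Function.Injective i) (j : Fin 3 → ι) :
    signedEq M i j = M.det ^ 2 * (N (j 2) (i 1) * N (j 1) (i 0) * N (j 0) (i 2) -
      N (j 1) (i 2) * N (j 2) (i 0) * N (j 0) (i 1)) := by
  rw [signedEq, adjugate_eq_of_mul_eq_one h, cof2_of_mul_eq_one h (hi.ne (by decide)),
    cof2_of_mul_eq_one h (hi.ne (by decide))]
  simp only [Matrix.smul_apply, smul_eq_mul]
  ring

theorem updateRow_add_single_self (M : Matrix ι ι R) (i k : ι) (t : R) (v : ι → R) :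
    (M + single i k t).updateRow i v = M.updateRow i v := by
  ext x y
  simp only [updateRow_apply, Matrix.add_apply, single_apply]
  grind

theorem updateRow_add_single_of_ne (M : Matrix ι ι R) {i k : ι} (h : i ≠ k) (j : ι) (t : R)
    (v : ι → R) :
    (M + single k j t).updateRow i v = M.updateRow i v + single k j t := by
  ext x y
  simp only [updateRow_apply, Matrix.add_apply, single_apply]
  grind

theorem adjugate_add_single_row (M : Matrix ι ι R) (i j k : ι) (t : R) :
    (M + single i k t).adjugate j i = M.adjugate j i := by
  rw [adjugate_apply, adjugate_apply, updateRow_add_single_self]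

theorem adjugate_add_single_col (M : Matrix ι ι R) (i j k : ι) (t : R) :
    (M + single k j t).adjugate j i = M.adjugate j i := by
  have := adjugate_add_single_row Mᵀ j i k t
  rwa [← transpose_single k j t, ← transpose_add, ← adjugate_transpose, ← adjugate_transpose,
    transpose_apply, transpose_apply] at this

theorem cof2_swap (M : Matrix ι ι R) {i i' : ι} (h : i ≠ i') (j j' : ι) :
    cof2 M i i' j j' = cof2 M i' i j' j := by
  rw [cof2, cof2, updateRow_comm _ h]

theorem cof2_add_single_row₂ (M : Matrix ι ι R) (i i' j j' k : ι) (t : R) :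
    cof2 (M + single i' k t) i i' j j' = cof2 M i i' j j' := by
  by_cases h : i = i'
  · subst h; simp only [cof2, updateRow_idem, updateRow_add_single_self]
  · simp only [cof2, updateRow_add_single_of_ne _ h, updateRow_add_single_self]

theorem cof2_add_single_row₁ (M : Matrix ι ι R) (i i' j j' k : ι) (t : R) :
    cof2 (M + single i k t) i i' j j' = cof2 M i i' j j' := by
  simp only [cof2, updateRow_add_single_self]

theorem cof2_add_single_col₂ (M : Matrix ι ι R) (i i' j j' k : ι) (t : R) :
    cof2 (M + single k j' t) i i' j j' = cof2 M i i' j j' := by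
  by_cases h : i = k
  · subst h; exact cof2_add_single_row₁ ..
  · rw [cof2_eq_adjugate, cof2_eq_adjugate, updateRow_add_single_of_ne _ h,
      adjugate_add_single_col]

theorem updateRow_add_single (M : Matrix ι ι R) (k l : ι) (t : R) :
    M + single k l t = M.updateRow k (M k + t • Pi.single l 1) := by
  ext x y
  simp only [updateRow_apply, Matrix.add_apply, single_apply, Pi.add_apply, Pi.smul_apply,
    Pi.single_apply, smul_eq_mul]
  grind

/-- A cofactor is affine in each entry outside its row, and `cof2` is its partial derivative. -/
theorem adjugate_add_single (M : Matrix ι ι R) {i i' : ι} (h : i ≠ i') (j j' : ι) (t : R) :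
    (M + single i' j' t).adjugate j i = M.adjugate j i + t * cof2 M i i' j j' := by
  rw [adjugate_apply, adjugate_apply, updateRow_add_single_of_ne _ h, updateRow_add_single,
    det_updateRow_add, det_updateRow_smul, updateRow_eq_self]
  rfl

/-- For `k = 1, 2` each factor omits the row or the column of the entry. For `k = 0` only the first
order cofactors change, and their two increments give the same product by `cof2_swap`. -/
theorem signedEq_add_single (M : Matrix ι ι R) {i j : Fin 3 → ι} (hi : Function.Injective i)
    (k : Fin 3) (t : R) :
    signedEq (M + single (i k) (j k) t) i j = signedEq M i j := by
  have h01 : i 0 ≠ i 1 := hi.ne (by decide)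
  have h02 : i 0 ≠ i 2 := hi.ne (by decide)
  fin_cases k
  · simp only [Fin.zero_eta, signedEq, cof2_add_single_row₁, adjugate_add_single _ h01.symm,
      adjugate_add_single _ h02.symm, cof2_swap _ h01.symm, cof2_swap _ h02.symm]
    ring
  · simp only [Fin.mk_one, signedEq, cof2_add_single_row₂, cof2_add_single_col₂,
      adjugate_add_single_col, adjugate_add_single_row]
  · simp only [Fin.reduceFinMk, signedEq, cof2_add_single_row₂, cof2_add_single_col₂,
      adjugate_add_single_col, adjugate_add_single_row]

/-- This position of the block lies outside `S`. The explicit linear coefficient serves both the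
irreducibility proof and the recovery of `S` from its variety. -/
theorem signedEq_add_single_zero_one (M : Matrix ι ι R) {i j : Fin 3 → ι}
    (hi : Function.Injective i) (t : R) :
    signedEq (M + single (i 0) (j 1) t) i j = signedEq M i j -
      t * (cof2 M (i 1) (i 0) (j 2) (j 1) * cof2 M (i 0) (i 2) (j 0) (j 1)) := by
  have h01 : i 0 ≠ i 1 := hi.ne (by decide)
  simp only [signedEq, cof2_add_single_row₁, adjugate_add_single_col,
    adjugate_add_single _ h01.symm]
  ring

theorem adjugate_updateRow_smul (M : Matrix ι ι R) (i j k : ι) (t : R) :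
    (M.updateRow i (t • M i)).adjugate j k = (if k = i then 1 else t) * M.adjugate j k := by
  rw [adjugate_apply, adjugate_apply]
  split_ifs with h
  · subst h; rw [updateRow_idem, one_mul]
  · rw [updateRow_comm _ (Ne.symm h), det_updateRow_smul]
    congr 2
    rw [← updateRow_comm _ (Ne.symm h), updateRow_eq_self]

theorem cof2_updateRow_smul (M : Matrix ι ι R) (i k k' j j' : ι) (t : R) :
    cof2 (M.updateRow i (t • M i)) k k' j j' =
      (if k = i ∨ k' = i then 1 else t) * cof2 M k k' j j' := by
  by_cases h : k = i
  · subst h; simp [cof2, updateRow_idem]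
  · have := adjugate_updateRow_smul (M.updateRow k (Pi.single j 1)) i j' k' t
    rw [updateRow_ne (Ne.symm h), updateRow_comm _ h] at this
    simpa [cof2_eq_adjugate, h] using this

/-- In both products the two factors together omit each of the three rows `i k` exactly once. Hence
the degree in row `r` is one if `r` is among them and two otherwise. -/
theorem signedEq_updateRow_smul (M : Matrix ι ι R) (r : ι) {i : Fin 3 → ι}
    (hi : Function.Injective i) (j : Fin 3 → ι) (t : R) :
    signedEq (M.updateRow r (t • M r)) i j =
      (if ∃ k, i k = r then t else t ^ 2) * signedEq M i j := by
  have h01 : i 0 ≠ i 1 := hi.ne (by decide)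
  have h02 : i 0 ≠ i 2 := hi.ne (by decide)
  have h12 : i 1 ≠ i 2 := hi.ne (by decide)
  simp only [signedEq, cof2_updateRow_smul, adjugate_updateRow_smul, Fin.exists_fin_succ,
    IsEmpty.exists_iff, or_false]
  by_cases h0 : i 0 = r
  · have h1 : i 1 ≠ r := h0 ▸ h01.symm
    have h2 : i 2 ≠ r := h0 ▸ h02.symm
    simp [h0, h1, h2]; ring
  · by_cases h1 : i 1 = r
    · have h2 : i 2 ≠ r := h1 ▸ h12.symm
      simp [h0, h1, h2]; ring
    · by_cases h2 : i 2 = r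
      · simp [h0, h1, h2]; ring
      · simp [h0, h1, h2]; ring

end MatrixAlgebra

/-! ### Corank two. -/

section Rank

variable {ι K : Type*} [Fintype ι] [DecidableEq ι] [Field K]

theorem rank_add_finrank_ker (A : Matrix ι ι K) :
    A.rank + Module.finrank K (LinearMap.ker A.mulVecLin) = Fintype.card ι := by
  rw [Matrix.rank, LinearMap.finrank_range_add_finrank_ker, Module.finrank_fintype_fun_eq_card]

theorem rank_le_of_mulVec_eq_zero {A : Matrix ι ι K} {x y : ι → K}
    (hxy : LinearIndependent K ![x, y]) (hx : A *ᵥ x = 0) (hy : A *ᵥ y = 0) :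
    A.rank ≤ Fintype.card ι - 2 := by
  have h : Submodule.span K (Set.range ![x, y]) ≤ LinearMap.ker A.mulVecLin := by
    rw [Submodule.span_le]
    rintro _ ⟨k, rfl⟩
    fin_cases k <;> simpa
  have h1 := Submodule.finrank_mono h
  rw [finrank_span_eq_card hxy, Fintype.card_fin] at h1
  have := rank_add_finrank_ker A
  omega

/-- A kernel of dimension at least two meets the hyperplane where coordinate `j` vanishes. A nonzero
vector there is also killed after row `i` is replaced by the unit vector at `j`. -/
theorem adjugate_eq_zero_of_rank_le (hι : 2 ≤ Fintype.card ι) {A : Matrix ι ι K}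
    (hA : A.rank ≤ Fintype.card ι - 2) : A.adjugate = 0 := by
  ext j i
  rw [adjugate_apply, Matrix.zero_apply, ← exists_mulVec_eq_zero_iff]
  let f : LinearMap.ker A.mulVecLin →ₗ[K] K := (LinearMap.proj j).comp (Submodule.subtype _)
  have h1 : 0 < Module.finrank K (LinearMap.ker f) := by
    have h2 := LinearMap.finrank_range_add_finrank_ker f
    have h3 := Submodule.finrank_le (LinearMap.range f)
    rw [Module.finrank_self] at h3
    have := rank_add_finrank_ker A
    omega
  have := Module.nontrivial_of_finrank_pos h1
  obtain ⟨x, hx⟩ := exists_ne (0 : LinearMap.ker f)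
  have hx0 : (x : LinearMap.ker A.mulVecLin).1 j = 0 := x.2
  have hxA : A *ᵥ (x : LinearMap.ker A.mulVecLin).1 = 0 := x.1.2
  refine ⟨x.1.1, fun h => hx (Subtype.ext (Subtype.ext h)), ?_⟩
  rw [updateRow_mulVec, hxA]
  ext k
  by_cases hk : k = i
  · subst hk; simp [hx0]
  · simp [hk]

end Rank

/-! ### Polynomials as functions of matrices. -/

section Evaluation

variable {n : ℕ}

theorem evalAt_add (M : Mat n) (P Q : Poly n) : evalAt M (P + Q) = evalAt M P + evalAt M Q :=
  map_add _ _ _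

theorem evalAt_sub (M : Mat n) (P Q : Poly n) : evalAt M (P - Q) = evalAt M P - evalAt M Q :=
  map_sub _ _ _

theorem evalAt_neg (M : Mat n) (P : Poly n) : evalAt M (-P) = -evalAt M P :=
  map_neg _ _

theorem evalAt_mul (M : Mat n) (P Q : Poly n) : evalAt M (P * Q) = evalAt M P * evalAt M Q :=
  map_mul _ _ _

theorem evalAt_zero (M : Mat n) : evalAt M 0 = 0 :=
  map_zero _

theorem evalAt_prod (M : Mat n) {ι : Type*} (s : Finset ι) (P : ι → Poly n) :
    evalAt M (∏ k ∈ s, P k) = ∏ k ∈ s, evalAt M (P k) :=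
  map_prod (MvPolynomial.eval _) _ _

theorem evalAt_C (M : Mat n) (c : ℂ) : evalAt M (MvPolynomial.C c) = c :=
  MvPolynomial.eval_C _

theorem evalAt_X (M : Mat n) (p : Fin n × Fin n) : evalAt M (MvPolynomial.X p) = M p.1 p.2 :=
  MvPolynomial.eval_X _

theorem poly_ext {P Q : Poly n} (h : ∀ M : Mat n, evalAt M P = evalAt M Q) : P = Q :=
  MvPolynomial.funext fun x => h (of fun i j => x (i, j))

/-- The generic matrix. -/
abbrev genericMat (n : ℕ) : Matrix (Fin n) (Fin n) (Poly n) :=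
  mvPolynomialX (Fin n) (Fin n) ℂ

theorem genericMat_map_eval (M : Mat n) :
    (genericMat n).map (MvPolynomial.eval fun p : Fin n × Fin n => M p.1 p.2) = M := by
  ext i j
  simp [mvPolynomialX]

theorem evalAt_adjugate (M : Mat n) (i j : Fin n) :
    evalAt M ((genericMat n).adjugate i j) = M.adjugate i j := by
  rw [evalAt, map_adjugate_apply, genericMat_map_eval]

theorem evalAt_cof2 (M : Mat n) (i i' j j' : Fin n) :
    evalAt M (cof2 (genericMat n) i i' j j') = cof2 M i i' j j' := by
  rw [evalAt, map_cof2, genericMat_map_eval]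

theorem evalAt_signedEq (M : Mat n) (i j : Fin 3 → Fin n) :
    evalAt M (signedEq (genericMat n) i j) = signedEq M i j := by
  rw [evalAt, map_signedEq, genericMat_map_eval]

theorem evalAt_det (M : Mat n) : evalAt M (genericMat n).det = M.det := by
  rw [evalAt, RingHom.map_det, RingHom.mapMatrix_apply, genericMat_map_eval]

theorem evalAt_smul_of_isHomogeneous {P : Poly n} {d : ℕ} (hP : P.IsHomogeneous d) (c : ℂ)
    (M : Mat n) : evalAt (c • M) P = c ^ d * evalAt M P := by
  rw [evalAt, evalAt, MvPolynomial.eval_eq, MvPolynomial.eval_eq, Finset.mul_sum]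
  refine Finset.sum_congr rfl fun e he => ?_
  have hd : ∑ p ∈ e.support, e p = d := by
    rw [← hP (MvPolynomial.mem_support_iff.mp he)]
    simp [Finsupp.weight_apply, Finsupp.sum]
  simp only [Matrix.smul_apply, smul_eq_mul, mul_pow, Finset.prod_mul_distrib,
    Finset.prod_pow_eq_pow_sum, hd]
  ring

end Evaluation

/-! ### Zariski closure, irreducibility and prime ideals. -/

section Closure

variable {n : ℕ} {X Y : Set (Mat n)}

theorem mem_idealOf {P : Poly n} : P ∈ idealOf X ↔ ∀ M ∈ X, evalAt M P = 0 := by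
  rw [idealOf, MvPolynomial.mem_vanishingIdeal_iff, Set.forall_mem_image]
  rfl

theorem subset_zariskiClosure : X ⊆ zariskiClosure X :=
  fun _ hM _ hP => mem_idealOf.1 hP _ hM

theorem idealOf_zariskiClosure : idealOf (zariskiClosure X) = idealOf X := by
  ext P
  refine ⟨fun h => mem_idealOf.2 fun M hM => mem_idealOf.1 h M (subset_zariskiClosure hM),
    fun h => mem_idealOf.2 fun M hM => hM P h⟩

theorem isZariskiClosed_zariskiClosure : IsZariskiClosed (zariskiClosure X) := by
  rw [IsZariskiClosed]
  conv_lhs => rw [zariskiClosure, idealOf_zariskiClosure]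
  rfl

theorem isZariskiClosed_zeros (P : Poly n) : IsZariskiClosed {M : Mat n | evalAt M P = 0} :=
  Set.Subset.antisymm (fun _ hM => hM P (mem_idealOf.2 fun _ h => h)) subset_zariskiClosure

theorem mem_of_isZariskiClosed (hX : IsZariskiClosed X) {M : Mat n}
    (h : ∀ P ∈ idealOf X, evalAt M P = 0) : M ∈ X := by
  rw [← hX]
  exact h

theorem zariskiClosure_subset (hY : IsZariskiClosed Y) (h : X ⊆ Y) : zariskiClosure X ⊆ Y :=
  fun _ hM => mem_of_isZariskiClosed hY fun P hP =>
    hM P (mem_idealOf.2 fun _ hN => mem_idealOf.1 hP _ (h hN))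

theorem exists_mem_idealOf_notMem (hY : IsZariskiClosed Y) (h : ¬ X ⊆ Y) :
    ∃ P ∈ idealOf Y, P ∉ idealOf X := by
  obtain ⟨M, hM, hMY⟩ := Set.not_subset.1 h
  by_contra! H
  exact hMY (mem_of_isZariskiClosed hY fun P hP => mem_idealOf.1 (H P hP) M hM)

theorem isIrredVariety_of_isPrime (hX : IsZariskiClosed X) (h : (idealOf X).IsPrime) :
    IsIrredVariety X := by
  refine ⟨hX, ?_, fun Y Z hY hZ hXYZ => ?_⟩
  · by_contra H
    refine h.ne_top ((Ideal.eq_top_iff_one _).2 (mem_idealOf.2 fun M hM => ?_))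
    exact absurd ⟨M, hM⟩ H
  · by_contra! H
    obtain ⟨P, hPY, hPX⟩ := exists_mem_idealOf_notMem hY H.1
    obtain ⟨Q, hQZ, hQX⟩ := exists_mem_idealOf_notMem hZ H.2
    have : P * Q ∈ idealOf X := mem_idealOf.2 fun M hM => by
      rw [evalAt_mul]
      rcases hXYZ hM with h | h
      · rw [mem_idealOf.1 hPY M h, zero_mul]
      · rw [mem_idealOf.1 hQZ M h, mul_zero]
    exact (h.mem_or_mem this).elim hPX hQX

theorem isPrime_of_isIrredVariety (hX : IsIrredVariety X) : (idealOf X).IsPrime := by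
  refine ⟨fun h => ?_, fun {P Q} hPQ => ?_⟩
  · obtain ⟨M, hM⟩ := hX.2.1
    have := mem_idealOf.1 ((Ideal.eq_top_iff_one _).1 h) M hM
    simp [evalAt] at this
  · refine (hX.2.2 _ _ (isZariskiClosed_zeros P) (isZariskiClosed_zeros Q) fun M hM => ?_).imp
      (fun h => mem_idealOf.2 fun M hM => h hM) (fun h => mem_idealOf.2 fun M hM => h hM)
    simpa [evalAt_mul] using mem_idealOf.1 hPQ M hM

end Closure

/-! ### Varieties with a principal ideal. -/

section Equation

variable {n : ℕ} {X Y : Set (Mat n)} {P Q : Poly n}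

theorem HasEquation.mem_iff (h : HasEquation X P) (hX : IsZariskiClosed X) {M : Mat n} :
    M ∈ X ↔ evalAt M P = 0 := by
  refine ⟨fun hM => mem_idealOf.1 (h ▸ Ideal.mem_span_singleton_self P) M hM,
    fun hM => mem_of_isZariskiClosed hX fun Q hQ => ?_⟩
  rw [HasEquation] at h
  rw [h, Ideal.mem_span_singleton] at hQ
  obtain ⟨R, rfl⟩ := hQ
  rw [evalAt_mul, hM, zero_mul]

theorem HasEquation.eq (hX : HasEquation X P) (hY : HasEquation Y P) (hX' : IsZariskiClosed X)
    (hY' : IsZariskiClosed Y) : X = Y := by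
  ext M
  rw [hX.mem_iff hX', hY.mem_iff hY']

theorem HasEquation.associated (hP : HasEquation X P) (hQ : HasEquation X Q) : Associated P Q :=
  Ideal.span_singleton_eq_span_singleton.1 (hP.symm.trans hQ)

theorem HasEquation.congr (hP : HasEquation X P) (h : Associated P Q) : HasEquation X Q :=
  hP.trans (Ideal.span_singleton_eq_span_singleton.2 h)

theorem exists_C_of_associated (h : Associated P Q) :
    ∃ c : ℂ, c ≠ 0 ∧ Q = MvPolynomial.C c * P := by
  obtain ⟨u, rfl⟩ := h
  obtain ⟨c, hc, hu⟩ := MvPolynomial.isUnit_iff_eq_C_of_isReduced.1 u.isUnit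
  exact ⟨c, hc.ne_zero, by rw [← hu, mul_comm]⟩

theorem totalDegree_eq_of_associated (h : Associated P Q) : Q.totalDegree = P.totalDegree := by
  obtain ⟨c, hc, rfl⟩ := exists_C_of_associated h
  by_cases hP : P = 0
  · rw [hP, mul_zero]
  · rw [MvPolynomial.totalDegree_mul_of_isDomain (by simpa using hc) hP,
      MvPolynomial.totalDegree_C, zero_add]

theorem HasEquation.isIrredVariety (h : HasEquation X P) (hP : Irreducible P)
    (hX : IsZariskiClosed X) : IsIrredVariety X := by
  refine isIrredVariety_of_isPrime hX ?_
  rw [HasEquation] at h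
  rw [h, Ideal.span_singleton_prime hP.ne_zero]
  exact hP.prime

/-- An irreducible polynomial that vanishes on `X` is the equation of its closure if `X` contains a
nonempty open part of the zero set of the polynomial. -/
theorem hasEquation_of_generic {f : Poly n} (hP : Irreducible P)
    (h0 : ∀ M ∈ X, evalAt M P = 0) {N : Mat n} (hN : evalAt N P = 0) (hf : evalAt N f ≠ 0)
    (h : ∀ M, evalAt M P = 0 → evalAt M f ≠ 0 → M ∈ X) : HasEquation (zariskiClosure X) P := by
  rw [HasEquation, idealOf_zariskiClosure]
  apply le_antisymm
  · intro R hR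
    have hprime : (Ideal.span {P}).IsPrime :=
      (Ideal.span_singleton_prime hP.ne_zero).2 hP.prime
    -- `R * f` vanishes on the whole zero set of `P`, so by the Nullstellensatz `P` divides it; `P`
    -- cannot divide `f`, because `f` is nonzero at the zero `N` of `P`.
    have h1 : R * f ∈ MvPolynomial.vanishingIdeal ℂ
        (MvPolynomial.zeroLocus ℂ (Ideal.span {P})) := by
      rw [MvPolynomial.mem_vanishingIdeal_iff]
      intro x hx
      have hx0 : evalAt (of fun i j => x (i, j)) P = 0 :=
        hx P (Ideal.mem_span_singleton_self P)
      change evalAt (of fun i j => x (i, j)) (R * f) = 0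
      rw [evalAt_mul]
      by_cases hxf : evalAt (of fun i j => x (i, j)) f = 0
      · rw [hxf, mul_zero]
      · rw [mem_idealOf.1 hR _ (h _ hx0 hxf), zero_mul]
    rw [MvPolynomial.vanishingIdeal_zeroLocus_eq_radical, hprime.radical] at h1
    refine (hprime.mem_or_mem h1).resolve_right fun h2 => hf ?_
    obtain ⟨S, rfl⟩ := Ideal.mem_span_singleton.1 h2
    rw [evalAt_mul, hN, zero_mul]
  · rw [Ideal.span_singleton_le_iff_mem, mem_idealOf]
    exact h0

/-- Inclusion makes the equation of the smaller variety divide that of the larger; irreducible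
polynomials dividing each other are associated. This excludes proper inclusions between the
candidate components. -/
theorem HasEquation.eq_of_subset (hP : HasEquation X P) (hQ : HasEquation Y Q)
    (hY : IsZariskiClosed Y) (hQi : Irreducible Q) (hPi : Irreducible P) (hX : IsZariskiClosed X)
    (h : X ⊆ Y) : X = Y := by
  have h1 : Q ∈ idealOf X := mem_idealOf.2 fun M hM => (hQ.mem_iff hY).1 (h hM)
  rw [HasEquation] at hP
  rw [hP, Ideal.mem_span_singleton] at h1
  have h2 : Associated P Q := hPi.associated_of_dvd hQi h1
  exact HasEquation.eq (HasEquation.congr hP h2) hQ hX hY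

/-- A homogeneous polynomial of positive degree defines a hypersurface. -/
theorem HasEquation.isHypersurfaceOfDegree {d : ℕ} (hP : HasEquation X P)
    (hX : IsZariskiClosed X) (hP0 : P ≠ 0) (hd : P.IsHomogeneous d) (hd0 : 0 < d) :
    IsHypersurfaceOfDegree X d := by
  refine ⟨⟨hX, ?_⟩, P, hP, hd.totalDegree hP0⟩
  have h1 : (1 : ℕ) ∈ {c : ℕ | ∀ W : Submodule ℂ (Mat n), Module.finrank ℂ W = c + 1 →
      ∃ M ∈ W, M ≠ 0 ∧ M ∈ X} := by
    intro W hW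
    obtain ⟨b⟩ : Nonempty (Module.Basis (Fin 2) ℂ W) :=
      ⟨Module.finBasisOfFinrankEq ℂ W hW⟩
    have hli : ∀ c d : ℂ, c • (b 0 : Mat n) + d • (b 1 : Mat n) = 0 → c = 0 ∧ d = 0 := by
      intro c d h
      have := Fintype.linearIndependent_iff.1 b.linearIndependent ![c, d] (by
        rw [Fin.sum_univ_two]
        exact Subtype.ext h)
      exact ⟨this 0, this 1⟩
    -- The restriction of `P` to the affine line `b 0 + t • b 1`; the remaining point of the
    -- projective line is `b 1`.
    let q : Polynomial ℂ := MvPolynomial.aeval (fun p : Fin n × Fin n =>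
      Polynomial.C ((b 0 : Mat n) p.1 p.2) +
        Polynomial.X * Polynomial.C ((b 1 : Mat n) p.1 p.2)) P
    have hq : ∀ t, q.eval t = evalAt ((b 0 : Mat n) + t • (b 1 : Mat n)) P := by
      intro t
      simp only [q, evalAt, Matrix.add_apply, Matrix.smul_apply, smul_eq_mul]
      rw [← Polynomial.coe_evalRingHom, MvPolynomial.aeval_def, MvPolynomial.hom_eval₂,
        MvPolynomial.eval, MvPolynomial.coe_eval₂Hom]
      congr 1
      · ext; simp
      · ext p; simp; exact mul_comm _ _
    by_cases h1 : evalAt (b 1 : Mat n) P = 0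
    · refine ⟨b 1, (b 1).2, fun h => ?_, (hP.mem_iff hX).2 h1⟩
      exact one_ne_zero (hli 0 1 (by simp [h])).2
    · have hroot : ∃ t, q.eval t = 0 := by
        by_contra! H
        have hqd : q.degree = 0 := by
          by_contra hne
          obtain ⟨t, ht⟩ := IsAlgClosed.exists_root q hne
          exact H t ht
        obtain ⟨c, hc⟩ : ∃ c, ∀ t, q.eval t = c := by
          rw [Polynomial.eq_C_of_degree_eq_zero hqd]
          exact ⟨_, fun t => Polynomial.eval_C⟩
        -- Without a root, `q` is a constant `c`. By homogeneity the restriction in the opposite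
        -- chart is then `c * X ^ d`, which vanishes at `0` since `d > 0`; so `P` would vanish at `b
        -- 1`.
        let q' : Polynomial ℂ := MvPolynomial.aeval (fun p : Fin n × Fin n =>
          Polynomial.X * Polynomial.C ((b 0 : Mat n) p.1 p.2) +
            Polynomial.C ((b 1 : Mat n) p.1 p.2)) P
        have hq' : ∀ t, q'.eval t = evalAt (t • (b 0 : Mat n) + (b 1 : Mat n)) P := by
          intro t
          simp only [q', evalAt, Matrix.add_apply, Matrix.smul_apply, smul_eq_mul]
          rw [← Polynomial.coe_evalRingHom, MvPolynomial.aeval_def, MvPolynomial.hom_eval₂,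
            MvPolynomial.eval, MvPolynomial.coe_eval₂Hom]
          congr 1
          · ext; simp
          · ext p; simp; exact mul_comm _ _
        have hqq : q' * 1 = Polynomial.X ^ d * Polynomial.C c := by
          refine Polynomial.eq_of_infinite_eval_eq _ _
            ((Set.finite_singleton (0 : ℂ)).infinite_compl.mono fun t ht => ?_)
          have ht : t ≠ 0 := ht
          simp only [Set.mem_ofPred_eq, mul_one, Polynomial.eval_mul, Polynomial.eval_pow,
            Polynomial.eval_X, Polynomial.eval_C]
          rw [hq', ← hc t⁻¹, hq, ← evalAt_smul_of_isHomogeneous hd, smul_add, smul_smul,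
            mul_inv_cancel₀ ht, one_smul]
        apply h1
        have := congrArg (Polynomial.eval 0) hqq
        rw [mul_one, hq'] at this
        simpa [hd0.ne'] using this
      obtain ⟨t, ht⟩ := hroot
      refine ⟨b 0 + t • b 1, W.add_mem (b 0).2 (W.smul_mem t (b 1).2), fun h => ?_,
        (hP.mem_iff hX).2 ((hq t).symm.trans ht)⟩
      exact one_ne_zero (hli 1 t (by simpa using h)).1
  have h0 : (0 : ℕ) ∉ {c : ℕ | ∀ W : Submodule ℂ (Mat n), Module.finrank ℂ W = c + 1 →
      ∃ M ∈ W, M ≠ 0 ∧ M ∈ X} := by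
    intro h
    obtain ⟨M, hM⟩ : ∃ M : Mat n, evalAt M P ≠ 0 := by
      by_contra! H
      exact hP0 (poly_ext fun M => by rw [H M, evalAt_zero])
    have hM0 : M ≠ 0 := by
      rintro rfl
      have := evalAt_smul_of_isHomogeneous hd 0 (0 : Mat n)
      rw [zero_smul, zero_pow hd0.ne', zero_mul] at this
      exact hM this
    obtain ⟨M', hM', hM'0, hM'X⟩ := h (Submodule.span ℂ {M}) (finrank_span_singleton hM0)
    obtain ⟨c, rfl⟩ := Submodule.mem_span_singleton.1 hM'
    rw [hP.mem_iff hX, evalAt_smul_of_isHomogeneous hd] at hM'X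
    refine hM ((mul_eq_zero.1 hM'X).resolve_left (pow_ne_zero _ ?_))
    rintro rfl
    exact hM'0 (zero_smul _ _)
  refine le_antisymm (Nat.sInf_le h1) (Nat.one_le_iff_ne_zero.2 fun h => ?_)
  rw [codim] at h
  exact h0 (h ▸ Nat.sInf_mem ⟨1, h1⟩)

end Equation

/-! ### Linear changes of coordinates. -/

section Pullback

variable {n : ℕ} {X Y : Set (Mat n)} {P Q : Poly n}

/-- The composition of a polynomial with a linear map. -/
def pullback (g : Mat n →ₗ[ℂ] Mat n) : Poly n →ₐ[ℂ] Poly n :=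
  MvPolynomial.aeval fun p => ∑ q : Fin n × Fin n,
    MvPolynomial.C (g (single q.1 q.2 1) p.1 p.2) * MvPolynomial.X q

theorem evalAt_pullback (g : Mat n →ₗ[ℂ] Mat n) (M : Mat n) (P : Poly n) :
    evalAt M (pullback g P) = evalAt (g M) P := by
  rw [evalAt, pullback, MvPolynomial.map_aeval, evalAt, MvPolynomial.eval]
  congr 2
  · ext; simp
  · ext p
    rw [← MvPolynomial.eval]
    simp only [map_sum, map_mul, MvPolynomial.eval_C, MvPolynomial.eval_X]
    conv_rhs => rw [matrix_eq_sum_single M]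
    simp only [map_sum, Matrix.sum_apply, Fintype.sum_prod_type]
    refine Finset.sum_congr rfl fun a _ => Finset.sum_congr rfl fun b _ => ?_
    have : single a b (M a b) = M a b • single a b (1 : ℂ) := by simp
    rw [this, map_smul, Matrix.smul_apply, smul_eq_mul, mul_comm]

theorem isHomogeneous_pullback (g : Mat n →ₗ[ℂ] Mat n) {d : ℕ} (h : P.IsHomogeneous d) :
    (pullback g P).IsHomogeneous d := by
  have := h.aeval (n := 1) (fun p => ∑ q : Fin n × Fin n,
    MvPolynomial.C (g (single q.1 q.2 1) p.1 p.2) * MvPolynomial.X q) fun p =>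
      MvPolynomial.IsHomogeneous.sum _ _ _ fun q _ => MvPolynomial.isHomogeneous_C_mul_X _ _
  rwa [one_mul] at this

theorem mem_idealOf_image (g : Mat n →ₗ[ℂ] Mat n) :
    P ∈ idealOf (g '' X) ↔ pullback g P ∈ idealOf X := by
  simp only [mem_idealOf, Set.forall_mem_image, evalAt_pullback]

theorem zariskiClosure_image (g : Mat n ≃ₗ[ℂ] Mat n) :
    zariskiClosure (g '' X) = g '' zariskiClosure X := by
  have key : ∀ (g : Mat n ≃ₗ[ℂ] Mat n) (X : Set (Mat n)),
      g '' zariskiClosure X ⊆ zariskiClosure (g '' X) := by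
    rintro g X _ ⟨M, hM, rfl⟩ P hP
    have := hM _ ((mem_idealOf_image (g : Mat n →ₗ[ℂ] Mat n)).1 hP)
    rwa [evalAt_pullback] at this
  refine Set.Subset.antisymm (fun M hM => ?_) (key g X)
  refine ⟨g.symm M, ?_, g.apply_symm_apply M⟩
  have := key g.symm (g '' X) ⟨M, hM, rfl⟩
  rwa [← Set.image_comp, show ⇑g.symm ∘ ⇑g = id from funext fun x => g.symm_apply_apply x,
    Set.image_id] at this

theorem HasEquation.image (h : HasEquation X P) (g : Mat n ≃ₗ[ℂ] Mat n) :
    HasEquation (g '' X) (pullback (g.symm : Mat n →ₗ[ℂ] Mat n) P) := by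
  rw [HasEquation] at h ⊢
  have key : ∀ Q, Q = pullback (g.symm : Mat n →ₗ[ℂ] Mat n) (pullback (g : Mat n →ₗ[ℂ] Mat n) Q) :=
    fun Q => poly_ext fun M => by simp [evalAt_pullback]
  have key' : ∀ Q, pullback (g : Mat n →ₗ[ℂ] Mat n) (pullback (g.symm : Mat n →ₗ[ℂ] Mat n) Q) = Q :=
    fun Q => poly_ext fun M => by simp [evalAt_pullback]
  ext Q
  have := mem_idealOf_image (X := X) (P := Q) (g : Mat n →ₗ[ℂ] Mat n)
  rw [LinearEquiv.coe_coe] at this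
  rw [this, h, Ideal.mem_span_singleton, Ideal.mem_span_singleton]
  constructor
  · intro h
    rw [key Q]
    exact map_dvd _ h
  · intro h
    rw [← key' P]
    exact map_dvd _ h

end Pullback

/-! ### Joins as closures of sums. -/

section Join

variable {n : ℕ}

/-- The sums of a matrix of rank at most `r` and a matrix supported on `S`. -/
def sumSet (r : ℕ) (S : Finset (Fin n × Fin n)) : Set (Mat n) :=
  {M | ∃ A ∈ rankLE n r, ∃ B : Mat n, (∀ p ∉ S, B p.1 p.2 = 0) ∧ M = A + B}

theorem mem_coordSpace {S : Finset (Fin n × Fin n)} {B : Mat n} :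
    B ∈ coordSpace S ↔ ∀ p ∉ S, B p.1 p.2 = 0 := by
  constructor
  · intro h p hp
    induction h using Submodule.span_induction with
    | mem x hx =>
      obtain ⟨q, hq, rfl⟩ := hx
      have : q ≠ p := fun h => hp (h ▸ hq)
      apply single_apply_of_ne
      exact fun h => this (Prod.ext h.1 h.2)
    | zero => rfl
    | add x y _ _ hx hy => rw [Matrix.add_apply, hx, hy, add_zero]
    | smul c x _ hx => rw [Matrix.smul_apply, hx, smul_zero]
  · intro h
    rw [matrix_eq_sum_single B]
    refine Submodule.sum_mem _ fun a _ => Submodule.sum_mem _ fun b _ => ?_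
    by_cases hab : (a, b) ∈ S
    · have : single a b (B a b) = B a b • single a b (1 : ℂ) := by simp
      rw [this]
      exact Submodule.smul_mem _ _ (Submodule.subset_span ⟨(a, b), hab, rfl⟩)
    · rw [h _ hab, single_zero]
      exact Submodule.zero_mem _

theorem smul_mem_rankLE {r : ℕ} {A : Mat n} (hA : A ∈ rankLE n r) (c : ℂ) : c • A ∈ rankLE n r := by
  have : c • A = (c • (1 : Mat n)) * A := by simp
  rw [this]
  exact (rank_mul_le_right _ _).trans hA

/-- Bounded rank and support in `S` are both stable under scaling, so the spans contribute nothing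
beyond the sums `A + B`. -/
theorem rigJoin_eq (r : ℕ) (S : Finset (Fin n × Fin n)) :
    rigJoin r S = zariskiClosure (sumSet r S) := by
  rw [rigJoin, join]
  congr 1
  ext M
  constructor
  · rintro ⟨A, hA, B, hB, hM⟩
    obtain ⟨a, b, rfl⟩ := Submodule.mem_span_pair.1 hM
    exact ⟨a • A, smul_mem_rankLE hA a, b • B,
      mem_coordSpace.1 ((coordSpace S).smul_mem b hB), rfl⟩
  · rintro ⟨A, hA, B, hB, rfl⟩
    exact ⟨A, hA, B, mem_coordSpace.2 hB, Submodule.mem_span_pair.2 ⟨1, 1, by simp⟩⟩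

theorem isZariskiClosed_rigJoin (r : ℕ) (S : Finset (Fin n × Fin n)) :
    IsZariskiClosed (rigJoin r S) :=
  isZariskiClosed_zariskiClosure

end Join

/-! ### An irreducibility criterion for polynomials linear in one variable. -/

section Linear

variable {n : ℕ}

/-- The substitution of zero for one variable. -/
def zeroAt (p : Fin n × Fin n) : Poly n →ₐ[ℂ] Poly n :=
  MvPolynomial.bind₁ fun q => if q = p then 0 else MvPolynomial.X q

theorem evalAt_zeroAt (p : Fin n × Fin n) (M : Mat n) (P : Poly n) :
    evalAt M (zeroAt p P) = evalAt (M + single p.1 p.2 (-M p.1 p.2)) P := by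
  rw [evalAt, zeroAt, ← MvPolynomial.aeval_eq_bind₁, MvPolynomial.map_aeval, evalAt,
    MvPolynomial.eval]
  congr 2
  · ext; simp
  · ext q
    rw [← MvPolynomial.eval]
    by_cases h : q = p
    · subst h; simp
    · rw [if_neg h, MvPolynomial.eval_X, Matrix.add_apply, single_apply_of_ne, add_zero]
      exact fun h' => h (Prod.ext h'.1.symm h'.2.symm)

theorem notMem_vars_zeroAt (p : Fin n × Fin n) (P : Poly n) : p ∉ (zeroAt p P).vars := by
  intro h
  obtain ⟨q, -, hq⟩ := MvPolynomial.mem_vars_bind₁ _ _ h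
  split_ifs at hq with hqp
  · simp at hq
  · rw [MvPolynomial.vars_X, Finset.mem_singleton] at hq
    exact hqp hq.symm

/-- A polynomial of degree one in a variable is irreducible if its leading coefficient in this
variable is prime to its value at zero. -/
theorem irreducible_of_linear {P f : Poly n} (p : Fin n × Fin n)
    (hf : ∀ (M : Mat n) (t : ℂ), evalAt (M + single p.1 p.2 t) f = evalAt M f)
    (hP : ∀ (M : Mat n) (t : ℂ), evalAt (M + single p.1 p.2 t) P = evalAt M P + t * evalAt M f)
    (hf0 : f ≠ 0) (h : IsRelPrime f (zeroAt p P)) : Irreducible P := by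
  have h1 : f = zeroAt p f := poly_ext fun M => by rw [evalAt_zeroAt, hf]
  have h2 : P = f * MvPolynomial.X p + zeroAt p P := poly_ext fun M => by
    rw [evalAt_add, evalAt_mul, evalAt_X, evalAt_zeroAt, hP]
    ring
  rw [h2]
  refine MvPolynomial.irreducible_mul_X_add f _ p hf0 ?_ (notMem_vars_zeroAt p P) h
  rw [h1]
  exact notMem_vars_zeroAt p f

/-- At a common zero of `g` and the leading coefficient `f`, the polynomial `P` equals its constant
term. If the irreducible `g` divided that term, `P` would vanish there too, so one suitable matrix
settles coprimality. -/
theorem isRelPrime_zeroAt {P f g : Poly n} (p : Fin n × Fin n) (hg : Irreducible g)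
    (hP : ∀ (M : Mat n) (t : ℂ), evalAt (M + single p.1 p.2 t) P = evalAt M P + t * evalAt M f)
    {M : Mat n} (hM : evalAt M g = 0) (hMf : evalAt M f = 0) (hMP : evalAt M P ≠ 0) :
    IsRelPrime g (zeroAt p P) := by
  rw [hg.isRelPrime_iff_not_dvd]
  rintro ⟨R, hR⟩
  have := evalAt_zeroAt p M P
  rw [hR, evalAt_mul, hM, zero_mul, hP, hMf, mul_zero, add_zero] at this
  exact hMP this.symm

end Linear

/-! ### Irreducibility, degree and signs of generic minors. -/

section GenericMinor

variable {n : ℕ}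

theorem evalAt_det_submatrix {m : ℕ} (M : Mat n) (r c : Fin m → Fin n) :
    evalAt M ((genericMat n).submatrix r c).det = (M.submatrix r c).det := by
  rw [evalAt, RingHom.map_det, RingHom.mapMatrix_apply, ← submatrix_map, genericMat_map_eval]

theorem exists_submatrix_eq {m : ℕ} {r c : Fin m → Fin n} (hr : Function.Injective r)
    (hc : Function.Injective c) (A : Matrix (Fin m) (Fin m) ℂ) :
    ∃ M : Mat n, M.submatrix r c = A := by
  refine ⟨of fun i j => Function.extend r (fun k => Function.extend c (A k) 0 j) 0 i, ?_⟩
  ext k l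
  rw [submatrix_apply, of_apply, hr.extend_apply, hc.extend_apply]

theorem det_add_single {m : ℕ} (A : Matrix (Fin m) (Fin m) ℂ) (k l : Fin m) (t : ℂ) :
    (A + single k l t).det = A.det + t * A.adjugate l k := by
  rw [updateRow_add_single, det_updateRow_add, det_updateRow_smul, updateRow_eq_self,
    adjugate_apply]

/-- Induction on the size: the determinant is linear in its corner entry, and the coefficient is the
complementary minor, irreducible by induction. -/
theorem irreducible_det_submatrix {m : ℕ} {r c : Fin (m + 1) → Fin n} (hr : Function.Injective r)
    (hc : Function.Injective c) : Irreducible ((genericMat n).submatrix r c).det := by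
  induction m with
  | zero =>
    rw [det_fin_one]
    exact MvPolynomial.X_prime.irreducible
  | succ m ih =>
    have hr' := hr.comp (Fin.succ_injective (m + 1))
    have hc' := hc.comp (Fin.succ_injective (m + 1))
    have hf := ih hr' hc'
    have hlin : ∀ (M : Mat n) (t : ℂ),
        evalAt (M + single (r 0) (c 0) t) ((genericMat n).submatrix r c).det =
          evalAt M ((genericMat n).submatrix r c).det +
            t * evalAt M ((genericMat n).submatrix (r ∘ Fin.succ) (c ∘ Fin.succ)).det := by
      intro M t
      have : (M + single (r 0) (c 0) t).submatrix r c = M.submatrix r c + single 0 0 t := by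
        ext k l
        simp [single_apply, hr.eq_iff, hc.eq_iff]
      rw [evalAt_det_submatrix, evalAt_det_submatrix, evalAt_det_submatrix, this, det_add_single,
        adjugate_fin_succ_eq_det_submatrix]
      simp [Fin.succAbove_zero, submatrix_submatrix]
    refine irreducible_of_linear (r 0, c 0) (fun M t => ?_) hlin hf.ne_zero ?_
    · rw [evalAt_det_submatrix, evalAt_det_submatrix]
      congr 1
      ext k l
      simp [hr.eq_iff, (Fin.succ_ne_zero k).symm]
    -- The matrix of the transposition of `0` and `1` has nonzero determinant, but its complementary
    -- minor has a zero first row.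
    · obtain ⟨M, hM⟩ := exists_submatrix_eq hr hc
        ((Equiv.swap (0 : Fin (m + 2)) 1).permMatrix ℂ)
      have h0 : evalAt M ((genericMat n).submatrix (r ∘ Fin.succ) (c ∘ Fin.succ)).det = 0 := by
        rw [evalAt_det_submatrix]
        refine det_eq_zero_of_row_eq_zero 0 fun l => ?_
        have := congrFun (congrFun hM 1) l.succ
        rw [submatrix_apply] at this
        rw [submatrix_apply, Function.comp_apply, Function.comp_apply, Fin.succ_zero_eq_one, this]
        simp [Equiv.Perm.permMatrix, Equiv.toPEquiv_apply, PEquiv.toMatrix_apply,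
          (Fin.succ_ne_zero l).symm]
      refine isRelPrime_zeroAt (r 0, c 0) hf hlin h0 h0 ?_
      rw [evalAt_det_submatrix, hM, det_permutation]
      simp

theorem isHomogeneous_det_submatrix {m : ℕ} (r c : Fin m → Fin n) :
    ((genericMat n).submatrix r c).det.IsHomogeneous m := by
  rw [det_apply]
  refine MvPolynomial.IsHomogeneous.sum _ _ _ fun σ _ => ?_
  have h : (∏ k, (genericMat n).submatrix r c (σ k) k).IsHomogeneous m := by
    have := MvPolynomial.IsHomogeneous.prod Finset.univ
      (fun k => (genericMat n).submatrix r c (σ k) k) (fun _ => 1)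
      fun k _ => MvPolynomial.isHomogeneous_X ℂ _
    simpa using this
  rcases Int.units_eq_one_or (Equiv.Perm.sign σ) with h1 | h1
  · rwa [h1, one_smul]
  · rw [h1, Units.neg_smul, one_smul]
    exact h.neg

/-- The sign of a pair of indices: `1` if the second is smaller. -/
def ordSign (a b : Fin n) : ℤ :=
  if b < a then 1 else -1

theorem ordSign_mul_self (a b : Fin n) : ordSign a b * ordSign a b = 1 := by
  unfold ordSign; split_ifs <;> rfl

/-- Deleting index `i` shifts the position of exactly the larger indices by one, which flips the
parity; `ordSign` records this. -/
theorem neg_one_pow_succAbove {m : ℕ} (i : Fin (m + 2)) (k : Fin (m + 1)) :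
    (-1 : ℤ) ^ (k : ℕ) = (-1) ^ (i.succAbove k : ℕ) * ordSign i (i.succAbove k) := by
  unfold ordSign
  by_cases h : k.castSucc < i
  · rw [Fin.succAbove_of_castSucc_lt _ _ h, if_pos h, Fin.val_castSucc, mul_one]
  · rw [Fin.succAbove_of_le_castSucc _ _ (not_lt.1 h), if_neg, Fin.val_succ, pow_succ]
    · ring
    · rw [not_lt] at h ⊢
      exact h.trans (Fin.castSucc_le_succ k)

theorem cof2_succAbove {R : Type*} [CommRing R] {m : ℕ}
    (A : Matrix (Fin (m + 2)) (Fin (m + 2)) R) (i j : Fin (m + 2)) (k l : Fin (m + 1)) :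
    cof2 A i (i.succAbove k) j (j.succAbove l) =
      (-1) ^ ((i : ℕ) + j) * ((-1) ^ ((k : ℕ) + l) *
        (A.submatrix (i.succAbove ∘ k.succAbove) (j.succAbove ∘ l.succAbove)).det) := by
  rw [cof2_swap _ (Fin.succAbove_ne i k).symm, cof2_eq_adjugate,
    adjugate_fin_succ_eq_det_submatrix]
  congr 1
  have : (A.updateRow (i.succAbove k) (Pi.single (j.succAbove l) 1)).submatrix
      i.succAbove j.succAbove = (A.submatrix i.succAbove j.succAbove).updateRow k
        (Pi.single l 1) := by
    ext a b
    simp only [submatrix_apply, updateRow_apply, Pi.single_apply,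
      (Fin.succAbove_right_injective).eq_iff]
  rw [this, ← adjugate_apply, adjugate_fin_succ_eq_det_submatrix, submatrix_submatrix]

theorem minor_eq_det_submatrix {m : ℕ} {I J : Finset (Fin n)} (hI : I.card = m) (hJ : J.card = m)
    {r c : Fin m → Fin n} (hr : StrictMono r) (hc : StrictMono c) (hrI : ∀ k, r k ∈ I)
    (hcJ : ∀ k, c k ∈ J) : minor I J = ((genericMat n).submatrix r c).det := by
  subst hI
  rw [minor, dif_pos hJ, Finset.orderEmbOfFin_unique rfl hrI hr,
    Finset.orderEmbOfFin_unique hJ hcJ hc]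

theorem delMinor_singleton {m : ℕ} (i j : Fin (m + 1)) :
    delMinor {i} {j} = ((genericMat (m + 1)).submatrix i.succAbove j.succAbove).det :=
  minor_eq_det_submatrix (by simp [Finset.card_compl]) (by simp [Finset.card_compl])
    (Fin.strictMono_succAbove i) (Fin.strictMono_succAbove j)
    (fun k => by simp [Fin.succAbove_ne]) (fun k => by simp [Fin.succAbove_ne])

theorem delMinor_pair {m : ℕ} (i j : Fin (m + 2)) (k l : Fin (m + 1)) :
    delMinor {i, i.succAbove k} {j, j.succAbove l} =
      ((genericMat (m + 2)).submatrix (i.succAbove ∘ k.succAbove)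
        (j.succAbove ∘ l.succAbove)).det := by
  refine minor_eq_det_submatrix ?_ ?_
    ((Fin.strictMono_succAbove i).comp (Fin.strictMono_succAbove k))
    ((Fin.strictMono_succAbove j).comp (Fin.strictMono_succAbove l))
    (fun x => ?_) (fun x => ?_)
  · rw [Finset.card_compl, Finset.card_pair (Fin.succAbove_ne i k).symm, Fintype.card_fin]; rfl
  · rw [Finset.card_compl, Finset.card_pair (Fin.succAbove_ne j l).symm, Fintype.card_fin]; rfl
  · simp [Fin.succAbove_ne, (Fin.succAbove_right_injective).eq_iff]
  · simp [Fin.succAbove_ne, (Fin.succAbove_right_injective).eq_iff]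

theorem adjugate_eq_delMinor (i j : Fin n) :
    (genericMat n).adjugate j i = (((-1) ^ ((i : ℕ) + j) : ℤ) : Poly n) * delMinor {i} {j} := by
  obtain _ | m := n
  · exact i.elim0
  · rw [adjugate_fin_succ_eq_det_submatrix, delMinor_singleton]
    push_cast
    rfl

theorem cof2_eq_delMinor {i i' j j' : Fin n} (hi : i ≠ i') (hj : j ≠ j') :
    cof2 (genericMat n) i i' j j' =
      (((-1) ^ ((i : ℕ) + i' + j + j') * ordSign i i' * ordSign j j' : ℤ) : Poly n) *
        delMinor {i, i'} {j, j'} := by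
  obtain _ | _ | m := n
  · exact i.elim0
  · exact absurd (Fin.ext (by omega)) hi
  · obtain ⟨k, rfl⟩ := Fin.exists_succAbove_eq hi.symm
    obtain ⟨l, rfl⟩ := Fin.exists_succAbove_eq hj.symm
    rw [cof2_succAbove, delMinor_pair, ← mul_assoc]
    congr 1
    have : ((-1 : ℤ) ^ ((i : ℕ) + j) * (-1) ^ ((k : ℕ) + l)) =
        ((-1) ^ ((i : ℕ) + (i.succAbove k : ℕ) + j + (j.succAbove l : ℕ)) *
          ordSign i (i.succAbove k) * ordSign j (j.succAbove l) : ℤ) := by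
      rw [pow_add (-1) (k : ℕ), neg_one_pow_succAbove i k, neg_one_pow_succAbove j l]
      ring
    rw [← this]
    push_cast
    rfl

theorem isUnit_intCast_of_mul_self {u : ℤ} (hu : u * u = 1) : IsUnit (u : Poly n) :=
  IsUnit.of_mul_eq_one (u : Poly n) (by rw [← Int.cast_mul, hu, Int.cast_one])

theorem neg_one_pow_mul_self (k : ℕ) : ((-1 : ℤ) ^ k) * (-1) ^ k = 1 := by
  rw [← mul_pow]; simp

theorem associated_adjugate_delMinor (i j : Fin n) :
    Associated (delMinor {i} {j}) ((genericMat n).adjugate j i) := by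
  rw [adjugate_eq_delMinor]
  exact associated_unit_mul_right _ _ (isUnit_intCast_of_mul_self (neg_one_pow_mul_self _))

theorem associated_cof2_delMinor {i i' j j' : Fin n} (hi : i ≠ i') (hj : j ≠ j') :
    Associated (delMinor {i, i'} {j, j'}) (cof2 (genericMat n) i i' j j') := by
  rw [cof2_eq_delMinor hi hj]
  refine associated_unit_mul_right _ _ (isUnit_intCast_of_mul_self ?_)
  linear_combination (ordSign i i' * ordSign i i') * (ordSign j j' * ordSign j j') *
    neg_one_pow_mul_self ((i : ℕ) + i' + j + j') + (ordSign j j' * ordSign j j') *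
    ordSign_mul_self i i' + ordSign_mul_self j j'

theorem irreducible_delMinor_singleton (hn : 2 ≤ n) (i j : Fin n) :
    Irreducible (delMinor {i} {j}) := by
  obtain ⟨m, rfl⟩ := Nat.exists_eq_add_of_le' hn
  rw [delMinor_singleton (m := m + 1)]
  exact irreducible_det_submatrix Fin.succAbove_right_injective Fin.succAbove_right_injective

theorem isHomogeneous_delMinor_singleton (i j : Fin n) :
    (delMinor {i} {j}).IsHomogeneous (n - 1) := by
  obtain _ | m := n
  · exact i.elim0
  · rw [delMinor_singleton]
    exact isHomogeneous_det_submatrix _ _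

theorem irreducible_delMinor_pair (hn : 3 ≤ n) {i i' j j' : Fin n} (hi : i ≠ i') (hj : j ≠ j') :
    Irreducible (delMinor {i, i'} {j, j'}) := by
  obtain ⟨m, rfl⟩ := Nat.exists_eq_add_of_le' hn
  obtain ⟨k, rfl⟩ := Fin.exists_succAbove_eq hi.symm
  obtain ⟨l, rfl⟩ := Fin.exists_succAbove_eq hj.symm
  rw [delMinor_pair (m := m + 1)]
  exact irreducible_det_submatrix
    (Fin.succAbove_right_injective.comp Fin.succAbove_right_injective)
    (Fin.succAbove_right_injective.comp Fin.succAbove_right_injective)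

theorem isHomogeneous_delMinor_pair {i i' j j' : Fin n} (hi : i ≠ i') (hj : j ≠ j') :
    (delMinor {i, i'} {j, j'}).IsHomogeneous (n - 2) := by
  obtain _ | _ | m := n
  · exact i.elim0
  · exact absurd (Fin.ext (by omega)) hi
  · obtain ⟨k, rfl⟩ := Fin.exists_succAbove_eq hi.symm
    obtain ⟨l, rfl⟩ := Fin.exists_succAbove_eq hj.symm
    rw [delMinor_pair]
    exact isHomogeneous_det_submatrix _ _

end GenericMinor

/-! ### Signs and degree of the two-term equation. -/

section TwoTerm

variable {n : ℕ}

theorem neg_one_pow_card_lt (i : Fin 3 → Fin n) (a : Fin 3) :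
    (-1 : ℤ) ^ (Finset.univ.filter fun k => i k < i a).card =
      ∏ k, if i k < i a then -1 else 1 := by
  rw [Finset.prod_ite, Finset.prod_const, Finset.prod_const_one, mul_one]

/-- The exponent counts smaller indices, whereas `ordSign` is `-1` on the others. Besides `0` there
are two labels, so the parities agree. -/
theorem labelSign_eq (i j : Fin 3 → Fin n) :
    labelSign i j = ordSign (i 0) (i 1) * ordSign (i 0) (i 2) *
      (ordSign (j 0) (j 1) * ordSign (j 0) (j 2)) := by
  rw [labelSign, pow_add, neg_one_pow_card_lt, neg_one_pow_card_lt, Fin.prod_univ_three,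
    Fin.prod_univ_three]
  simp only [lt_irrefl, if_false, one_mul, ordSign]
  split_ifs <;> rfl

/-- Put each label first in turn and multiply the three signs. Every pair of rows contributes `-1`,
hence the rows give `-1` in total, and so do the columns. The product is `1`, so the signs are not
all `-1`. -/
theorem exists_labelSign_eq_one {i j : Fin 3 → Fin n} (hi : Function.Injective i)
    (hj : Function.Injective j) : ∃ e : Equiv.Perm (Fin 3), labelSign (i ∘ e) (j ∘ e) = 1 := by
  have key : ∀ a b c : Fin n, a ≠ b → a ≠ c → b ≠ c →
      ordSign a b * ordSign a c * (ordSign b a * ordSign b c) * (ordSign c b * ordSign c a) =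
        -1 := by
    intro a b c hab hac hbc
    simp only [ordSign]
    split_ifs <;> first | rfl | (exfalso; omega)
  have h1 := key _ _ _ (hi.ne (by decide : (0 : Fin 3) ≠ 1)) (hi.ne (by decide : (0 : Fin 3) ≠ 2))
    (hi.ne (by decide : (1 : Fin 3) ≠ 2))
  have h2 := key _ _ _ (hj.ne (by decide : (0 : Fin 3) ≠ 1)) (hj.ne (by decide : (0 : Fin 3) ≠ 2))
    (hj.ne (by decide : (1 : Fin 3) ≠ 2))
  have hpm : ∀ e : Equiv.Perm (Fin 3), labelSign (i ∘ e) (j ∘ e) = 1 ∨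
      labelSign (i ∘ e) (j ∘ e) = -1 := fun e => neg_one_pow_eq_or ℤ _
  by_contra! H
  have h3 := (hpm 1).resolve_left (H 1)
  have h4 := (hpm (Equiv.swap 0 1)).resolve_left (H _)
  have h5 := (hpm (Equiv.swap 0 2)).resolve_left (H _)
  rw [labelSign_eq] at h3 h4 h5
  simp only [Function.comp_apply, Equiv.Perm.one_apply, Equiv.swap_apply_left,
    Equiv.swap_apply_right, Equiv.swap_apply_of_ne_of_ne (show (2 : Fin 3) ≠ 0 by decide)
      (show (2 : Fin 3) ≠ 1 by decide), Equiv.swap_apply_of_ne_of_ne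
      (show (1 : Fin 3) ≠ 0 by decide) (show (1 : Fin 3) ≠ 2 by decide)] at h3 h4 h5
  have h6 : ∀ a b c d e f : ℤ, a = -1 → b = -1 → c = -1 → d = -1 → e = -1 →
      d * e = a * b * c → False := by
    rintro _ _ _ _ _ _ rfl rfl rfl rfl rfl h
    norm_num at h
  refine h6 _ _ _ _ _ 0 h3 h4 h5 h1 h2 ?_
  ring

/-- Both products carry the same sign `T` from the sum of the indices. The ratio of their order
signs is `labelSign i j`. -/
theorem associated_twoTermEq {i j : Fin 3 → Fin n} (hi : Function.Injective i)
    (hj : Function.Injective j) :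
    Associated (twoTermEq (labelSign i j) i j) (signedEq (genericMat n) i j) := by
  have hi1 : i 0 ≠ i 1 := hi.ne (by decide)
  have hi2 : i 0 ≠ i 2 := hi.ne (by decide)
  have hj1 : j 0 ≠ j 1 := hj.ne (by decide)
  have hj2 : j 0 ≠ j 2 := hj.ne (by decide)
  set T : ℤ := (-1) ^ ((i 0 : ℕ) + i 1 + i 2 + j 0 + j 1 + j 2) with hT
  have hTT : T * T = 1 := neg_one_pow_mul_self _
  have h : signedEq (genericMat n) i j =
      ((T * ordSign (i 0) (i 1) * ordSign (j 0) (j 2) : ℤ) : Poly n) *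
        twoTermEq (labelSign i j) i j := by
    rw [signedEq, adjugate_eq_delMinor, adjugate_eq_delMinor, cof2_eq_delMinor hi1 hj2,
      cof2_eq_delMinor hi2 hj1, twoTermEq, labelSign_eq]
    have e1 : ((-1 : ℤ) ^ ((i 2 : ℕ) + j 1)) * ((-1) ^ ((i 0 : ℕ) + i 1 + j 0 + j 2) *
        ordSign (i 0) (i 1) * ordSign (j 0) (j 2)) =
        T * ordSign (i 0) (i 1) * ordSign (j 0) (j 2) := by
      rw [hT]; ring
    have e2 : ((-1 : ℤ) ^ ((i 1 : ℕ) + j 2)) * ((-1) ^ ((i 0 : ℕ) + i 2 + j 0 + j 1) *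
        ordSign (i 0) (i 2) * ordSign (j 0) (j 1)) =
        T * ordSign (i 0) (i 1) * ordSign (j 0) (j 2) *
          (ordSign (i 0) (i 1) * ordSign (i 0) (i 2) *
            (ordSign (j 0) (j 1) * ordSign (j 0) (j 2))) := by
      have : T * ordSign (i 0) (i 1) * ordSign (j 0) (j 2) *
          (ordSign (i 0) (i 1) * ordSign (i 0) (i 2) *
            (ordSign (j 0) (j 1) * ordSign (j 0) (j 2))) =
          T * ordSign (i 0) (i 2) * ordSign (j 0) (j 1) *
            (ordSign (i 0) (i 1) * ordSign (i 0) (i 1)) *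
            (ordSign (j 0) (j 2) * ordSign (j 0) (j 2)) := by ring
      rw [this, ordSign_mul_self, ordSign_mul_self, hT]
      ring
    have e1' := congrArg (Int.cast (R := Poly n)) e1
    have e2' := congrArg (Int.cast (R := Poly n)) e2
    rw [Int.cast_mul] at e1' e2'
    rw [Int.cast_mul _ (ordSign (i 0) (i 1) * ordSign (i 0) (i 2) * _)] at e2'
    linear_combination delMinor {i 2} {j 1} * delMinor {i 0, i 1} {j 0, j 2} * e1' -
      delMinor {i 1} {j 2} * delMinor {i 0, i 2} {j 0, j 1} * e2'
  rw [h]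
  refine associated_unit_mul_right _ _ (isUnit_intCast_of_mul_self ?_)
  linear_combination (ordSign (i 0) (i 1) * ordSign (i 0) (i 1)) *
    (ordSign (j 0) (j 2) * ordSign (j 0) (j 2)) * hTT +
    (ordSign (j 0) (j 2) * ordSign (j 0) (j 2)) * ordSign_mul_self (i 0) (i 1) +
    ordSign_mul_self (j 0) (j 2)

theorem isHomogeneous_twoTermEq (hn : 2 ≤ n) (ε : ℤ) {i j : Fin 3 → Fin n}
    (hi : Function.Injective i) (hj : Function.Injective j) :
    (twoTermEq ε i j).IsHomogeneous (2 * n - 3) := by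
  have hd : n - 1 + (n - 2) = 2 * n - 3 := by omega
  have h1 := (isHomogeneous_delMinor_singleton (i 2) (j 1)).mul
    (isHomogeneous_delMinor_pair (hi.ne (by decide : (0 : Fin 3) ≠ 1))
      (hj.ne (by decide : (0 : Fin 3) ≠ 2)))
  have h2 := (isHomogeneous_delMinor_singleton (i 1) (j 2)).mul
    (isHomogeneous_delMinor_pair (hi.ne (by decide : (0 : Fin 3) ≠ 2))
      (hj.ne (by decide : (0 : Fin 3) ≠ 1)))
  rw [hd] at h1 h2
  have h3 := (MvPolynomial.isHomogeneous_C (Fin n × Fin n) (ε : ℂ)).mul h2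
  rw [zero_add, map_intCast] at h3
  exact h1.sub h3

end TwoTerm

/-! ### Sums of a matrix of corank two and a matrix with prescribed support. -/

section Support

variable {n : ℕ}

theorem eq_sum_single_of_support {S : Finset (Fin n × Fin n)} {B : Mat n}
    (hB : ∀ p ∉ S, B p.1 p.2 = 0) : B = ∑ p ∈ S, single p.1 p.2 (B p.1 p.2) := by
  conv_lhs => rw [matrix_eq_sum_single B]
  rw [← Fintype.sum_prod_type' fun a b => single a b (B a b)]
  refine (Finset.sum_subset (Finset.subset_univ S) fun p _ hp => ?_).symm
  rw [hB p hp, single_zero]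

/-- A function on matrices that does not depend on the entries in `S`. -/
theorem apply_add_eq_of_support {α : Type*} {S : Finset (Fin n × Fin n)} {φ : Mat n → α}
    (h : ∀ p ∈ S, ∀ (M : Mat n) (t : ℂ), φ (M + single p.1 p.2 t) = φ M) (A : Mat n) {B : Mat n}
    (hB : ∀ p ∉ S, B p.1 p.2 = 0) : φ (A + B) = φ A := by
  rw [eq_sum_single_of_support hB]
  have : ∀ T : Finset (Fin n × Fin n), T ⊆ S →
      φ (A + ∑ p ∈ T, single p.1 p.2 (B p.1 p.2)) = φ A := by
    intro T
    induction T using Finset.induction_on with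
    | empty => intro _; rw [Finset.sum_empty, add_zero]
    | insert p T hp ih =>
      intro hT
      rw [Finset.sum_insert hp, add_comm (single p.1 p.2 _), ← add_assoc,
        h p (hT (Finset.mem_insert_self p T)), ih ((Finset.subset_insert p T).trans hT)]
  exact this S subset_rfl

theorem adjugate_eq_zero_of_mem_rankLE (hn : 2 ≤ n) {A : Mat n} (hA : A ∈ rankLE n (n - 2)) :
    A.adjugate = 0 :=
  adjugate_eq_zero_of_rank_le (by simpa using hn) (by simpa [rankLE] using hA)

/-- A cofactor vanishes on the sums for `S` if `S` is contained in its row and its column. -/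
theorem adjugate_eq_zero_of_mem_sumSet (hn : 2 ≤ n) {S : Finset (Fin n × Fin n)} {i c : Fin n}
    (hS : ∀ p ∈ S, p.1 = i ∨ p.2 = c) {M : Mat n} (hM : M ∈ sumSet (n - 2) S) :
    M.adjugate c i = 0 := by
  obtain ⟨A, hA, B, hB, rfl⟩ := hM
  have := apply_add_eq_of_support (S := S) (φ := fun M : Mat n => M.adjugate c i)
    (fun p hp M t => by
      rcases hS p hp with h | h
      · rw [h]; exact adjugate_add_single_row ..
      · rw [h]; exact adjugate_add_single_col ..) A hB
  rw [this, adjugate_eq_zero_of_mem_rankLE hn hA, Matrix.zero_apply]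

/-- If `B * N` fixes `x`, then `N *ᵥ x` lies in the kernel of `M - B`, and `N` preserves
independence. This is how every decomposition `M = A + B` below is produced. -/
theorem rank_sub_le_of_mul_eq_one {M N B : Mat n} (h : M * N = 1) {x y : Fin n → ℂ}
    (hxy : LinearIndependent ℂ ![x, y]) (hx : B *ᵥ (N *ᵥ x) = x) (hy : B *ᵥ (N *ᵥ y) = y) :
    M - B ∈ rankLE n (n - 2) := by
  have hM : ∀ z, M *ᵥ (N *ᵥ z) = z := fun z => by rw [mulVec_mulVec, h, one_mulVec]
  have hxy' : LinearIndependent ℂ ![N *ᵥ x, N *ᵥ y] := by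
    rw [LinearIndependent.pair_iff] at hxy ⊢
    intro s t hst
    apply hxy
    have := congrArg (M *ᵥ ·) hst
    simpa [mulVec_add, mulVec_smul, hM] using this
  have := rank_le_of_mulVec_eq_zero (A := M - B) hxy'
    (by rw [sub_mulVec, hM, hx, sub_self]) (by rw [sub_mulVec, hM, hy, sub_self])
  simpa [rankLE] using this

end Support

/-! ### Explicit invertible matrices. -/

section Witness

variable {n : ℕ}

/-- The matrix of a permutation, with entries at `(e b, b)`. -/
def permMat (e : Equiv.Perm (Fin n)) : Mat n :=
  of fun a b => if a = e b then 1 else 0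

theorem permMat_apply (e : Equiv.Perm (Fin n)) (a b : Fin n) :
    permMat e a b = if a = e b then 1 else 0 :=
  rfl

theorem permMat_inv_mul (e : Equiv.Perm (Fin n)) : permMat e⁻¹ * permMat e = 1 := by
  ext a b
  rw [mul_apply, one_apply]
  simp [permMat_apply, Equiv.eq_symm_apply]

theorem exists_perm_eq {i j : Fin 3 → Fin n} (hi : Function.Injective i)
    (hj : Function.Injective j) : ∃ e : Equiv.Perm (Fin n), ∀ k, e (i k) = j k :=
  Equiv.Perm.exists_extending_pair i j hi hj

theorem det_ne_zero_of_mul_eq_one {M N : Mat n} (h : M * N = 1) : M.det ≠ 0 := fun h0 => by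
  have := congrArg det h
  rw [det_mul, h0, zero_mul, det_one] at this
  exact zero_ne_one this

/-- There is an invertible matrix whose submatrix at the given positions has the entries `2` on the
diagonal and `1` off the diagonal. -/
theorem exists_mul_eq_one_of_injective {i j : Fin 3 → Fin n} (hi : Function.Injective i)
    (hj : Function.Injective j) : ∃ M N : Mat n, M * N = 1 ∧
      ∀ k l, N (j k) (i l) = if k = l then 2 else 1 := by
  obtain ⟨e, he⟩ := exists_perm_eq hi hj
  let w : Fin n → ℂ := fun a => if a ∈ Finset.univ.image i then 1 else 0
  have hw : ∑ a, w a * w a = 3 := by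
    simp only [w, mul_ite, mul_one, mul_zero, Finset.sum_ite_mem, Finset.univ_inter,
      ← ite_and, and_self]
    rw [Finset.sum_const, Finset.card_image_of_injective _ hi]
    simp
  have hV : vecMulVec w w * vecMulVec w w = (3 : ℂ) • vecMulVec w w := by
    ext x y
    rw [mul_apply, Matrix.smul_apply, smul_eq_mul, ← hw, Finset.sum_mul]
    refine Finset.sum_congr rfl fun a _ => ?_
    simp only [vecMulVec_apply]
    ring
  -- The Sherman–Morrison formula: `w` is the indicator of the three rows, so `w` has square sum `3`
  -- and the factor is `1 / (1 + 3)`.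
  have h1 : (1 - (1 / 4 : ℂ) • vecMulVec w w) * (1 + vecMulVec w w) = (1 : Mat n) := by
    rw [sub_mul, mul_add, one_mul, smul_mul, mul_add, mul_one, hV, one_mul]
    module
  refine ⟨(1 - (1 / 4 : ℂ) • vecMulVec w w) * permMat e⁻¹, permMat e * (1 + vecMulVec w w), ?_, ?_⟩
  · rw [Matrix.mul_assoc, ← Matrix.mul_assoc (permMat e⁻¹), permMat_inv_mul, Matrix.one_mul, h1]
  · intro k l
    have hwi : ∀ k, w (i k) = 1 := fun k => by simp [w]
    rw [mul_apply, Finset.sum_eq_single (i k)]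
    · rw [permMat_apply, he, if_pos rfl, one_mul, Matrix.add_apply, one_apply, vecMulVec_apply, hwi,
        hwi]
      by_cases hkl : k = l
      · rw [if_pos (congrArg i hkl), if_pos hkl]; norm_num
      · rw [if_neg fun h => hkl (hi h), if_neg hkl]; norm_num
    · intro b _ hb
      rw [permMat_apply, if_neg, zero_mul]
      rw [← he]
      exact fun h => hb (e.injective h).symm
    · simp

end Witness

/-! ### The equation of a transversal set. -/

section TypeOneEquation

variable {n : ℕ} {i j : Fin 3 → Fin n}

theorem three_le_of_injective (hi : Function.Injective i) : 3 ≤ n := by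
  simpa using Fintype.card_le_of_injective i hi

theorem irreducible_signedEq (hi : Function.Injective i) (hj : Function.Injective j) :
    Irreducible (signedEq (genericMat n) i j) := by
  have hn := three_le_of_injective hi
  have hi01 : i 0 ≠ i 1 := hi.ne (by decide)
  have hi02 : i 0 ≠ i 2 := hi.ne (by decide)
  have hj01 : j 0 ≠ j 1 := hj.ne (by decide)
  have hj12 : j 1 ≠ j 2 := hj.ne (by decide)
  have h1 : Irreducible (cof2 (genericMat n) (i 1) (i 0) (j 2) (j 1)) :=
    (associated_cof2_delMinor hi01.symm hj12.symm).irreducible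
      (irreducible_delMinor_pair hn hi01.symm hj12.symm)
  have h2 : Irreducible (cof2 (genericMat n) (i 0) (i 2) (j 0) (j 1)) :=
    (associated_cof2_delMinor hi02 hj01).irreducible
      (irreducible_delMinor_pair hn hi02 hj01)
  have hlin : ∀ (M : Mat n) (t : ℂ),
      evalAt (M + single (i 0) (j 1) t) (signedEq (genericMat n) i j) =
        evalAt M (signedEq (genericMat n) i j) + t * evalAt M
          (-(cof2 (genericMat n) (i 1) (i 0) (j 2) (j 1) *
            cof2 (genericMat n) (i 0) (i 2) (j 0) (j 1))) := by
    intro M t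
    rw [evalAt_signedEq, evalAt_signedEq, signedEq_add_single_zero_one _ hi, evalAt_neg,
      evalAt_mul, evalAt_cof2, evalAt_cof2]
    ring
  -- The cyclic shift makes one cyclic product of the inverse equal to `1` and the other `0`, while
  -- both factors of the linear coefficient vanish.
  obtain ⟨e, he⟩ := exists_perm_eq hi (hj.comp (Equiv.injective (finRotate 3).symm))
  have he0 : e (i 0) = j 2 := he 0
  have he1 : e (i 1) = j 0 := he 1
  have he2 : e (i 2) = j 1 := he 2
  have hMN := permMat_inv_mul e
  have hdet := det_ne_zero_of_mul_eq_one hMN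
  have hM1 : evalAt (permMat e⁻¹) (cof2 (genericMat n) (i 1) (i 0) (j 2) (j 1)) = 0 := by
    rw [evalAt_cof2, cof2_of_mul_eq_one hMN hi01.symm]
    simp [permMat_apply, he0, he1, hj.eq_iff]
  have hM2 : evalAt (permMat e⁻¹) (cof2 (genericMat n) (i 0) (i 2) (j 0) (j 1)) = 0 := by
    rw [evalAt_cof2, cof2_of_mul_eq_one hMN hi02]
    simp [permMat_apply, he0, he2, hj.eq_iff]
  have hMP : evalAt (permMat e⁻¹) (signedEq (genericMat n) i j) ≠ 0 := by
    rw [evalAt_signedEq, signedEq_of_mul_eq_one hMN hi]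
    simp [permMat_apply, he0, he1, he2, hj.eq_iff, hdet]
  have hMf : evalAt (permMat e⁻¹) (-(cof2 (genericMat n) (i 1) (i 0) (j 2) (j 1) *
            cof2 (genericMat n) (i 0) (i 2) (j 0) (j 1))) = 0 := by
    rw [evalAt_neg, evalAt_mul, hM1, zero_mul, neg_zero]
  refine irreducible_of_linear (i 0, j 1) (fun M t => ?_) hlin
    (neg_ne_zero.2 (mul_ne_zero h1.ne_zero h2.ne_zero)) ?_
  · simp only [evalAt_neg, evalAt_mul, evalAt_cof2, cof2_add_single_row₁, cof2_add_single_row₂]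
  · rw [IsRelPrime.neg_left_iff]
    exact (isRelPrime_zeroAt (i 0, j 1) h1 hlin hM1 hMf hMP).mul_left
      (isRelPrime_zeroAt (i 0, j 1) h2 hlin hM2 hMf hMP)

theorem signedEq_eq_zero_of_mem_sumSet (hi : Function.Injective i) {M : Mat n}
    (hM : M ∈ sumSet (n - 2) (entries i j)) : signedEq M i j = 0 := by
  have hn := three_le_of_injective hi
  obtain ⟨A, hA, B, hB, rfl⟩ := hM
  have := apply_add_eq_of_support (S := entries i j) (φ := fun M : Mat n => signedEq M i j)
    (fun p hp M t => by
      simp only [entries, Finset.mem_insert, Finset.mem_singleton] at hp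
      rcases hp with rfl | rfl | rfl
      · exact signedEq_add_single M hi 0 t
      · exact signedEq_add_single M hi 1 t
      · exact signedEq_add_single M hi 2 t) A hB
  rw [this, signedEq, adjugate_eq_zero_of_mem_rankLE (by omega) hA, Matrix.zero_apply,
    Matrix.zero_apply, zero_mul, zero_mul, sub_zero]

/-- If the submatrix of the inverse at the positions of a transversal set is a rank one matrix up to
its diagonal, then the matrix is a sum of a matrix of corank two and one supported on the set. -/
theorem mem_sumSet_of_rank_one {M N : Mat n} (h : M * N = 1) (hi : Function.Injective i)
    {u v : Fin 3 → ℂ} (hN : ∀ k l, k ≠ l → N (j k) (i l) = u k * v l)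
    (hd : ∀ k, N (j k) (i k) - u k * v k ≠ 0) (hv : v 0 ≠ 0) :
    M ∈ sumSet (n - 2) (entries i j) := by
  -- After subtracting the rank one part, the block of `N` is diagonal; `B` holds the inverses of
  -- these diagonal entries. Hence `B * N` fixes the vectors on the rows `i k` whose coordinates are
  -- annihilated by `v`.
  let B : Mat n := ∑ k, single (i k) (j k) (N (j k) (i k) - u k * v k)⁻¹
  let z : (Fin 3 → ℂ) → Fin n → ℂ := fun a => ∑ l, Pi.single (i l) (a l)
  have hz : ∀ a k, z a (i k) = a k := by
    intro a k
    simp only [z, Finset.sum_apply, Pi.single_apply, hi.eq_iff]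
    simp
  have hNz : ∀ a k, (N *ᵥ z a) (j k) = ∑ l, N (j k) (i l) * a l := by
    intro a k
    simp only [z, mulVec_sum, Finset.sum_apply, mulVec_single]
    simp
  have hBz : ∀ a, ∑ l, v l * a l = 0 → B *ᵥ (N *ᵥ z a) = z a := by
    intro a ha
    have h1 : ∀ k, (N *ᵥ z a) (j k) = (N (j k) (i k) - u k * v k) * a k := by
      intro k
      have : ∀ l, N (j k) (i l) * a l = u k * (v l * a l) +
          if k = l then (N (j k) (i k) - u k * v k) * a k else 0 := by
        intro l
        split_ifs with hkl
        · subst hkl; ring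
        · rw [hN k l hkl]; ring
      rw [hNz, Finset.sum_congr rfl fun l _ => this l, Finset.sum_add_distrib, ← Finset.mul_sum, ha]
      simp
    simp only [B, sum_mulVec, single_mulVec, h1, z]
    refine Finset.sum_congr rfl fun k _ => ?_
    rw [inv_mul_cancel_left₀ (hd k)]
    rfl
  -- A basis of the plane annihilated by `v`, using `v 0 ≠ 0`.
  have hli : LinearIndependent ℂ ![z ![v 1, -v 0, 0], z ![v 2, 0, -v 0]] := by
    rw [LinearIndependent.pair_iff]
    intro s t hst
    have h1 := congrFun hst (i 1)
    have h2 := congrFun hst (i 2)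
    simp only [Pi.add_apply, Pi.smul_apply, hz] at h1 h2
    simpa [hv] using And.intro h1 h2
  refine ⟨M - B, rank_sub_le_of_mul_eq_one h hli (hBz _ ?_) (hBz _ ?_), B, fun p hp => ?_,
    (sub_add_cancel M B).symm⟩
  · simp [Fin.sum_univ_three]; ring
  · simp [Fin.sum_univ_three]; ring
  · simp only [B, Matrix.sum_apply]
    refine Finset.sum_eq_zero fun k _ => single_apply_of_ne _ _ _ _ _ ?_
    rintro ⟨h1, h2⟩
    apply hp
    simp only [entries, Finset.mem_insert, Finset.mem_singleton, Prod.ext_iff, ← h1, ← h2]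
    fin_cases k <;> simp

theorem hasEquation_signedEq (hi : Function.Injective i) (hj : Function.Injective j) :
    HasEquation (rigJoin (n - 2) (entries i j)) (signedEq (genericMat n) i j) := by
  rw [rigJoin_eq]
  obtain ⟨M₀, N₀, h₀, hN₀⟩ := exists_mul_eq_one_of_injective hi hj
  let a : Fin 3 → Fin 3 → Poly n := fun k l => (genericMat n).adjugate (j k) (i l)
  -- The factors keep `M` invertible, all off-diagonal entries of the block nonzero, and each
  -- diagonal entry different from that of the rank one matrix chosen below.
  let f : Poly n := (genericMat n).det * (a 0 1 * a 0 2 * a 1 0 * a 1 2 * a 2 0 * a 2 1) *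
    (a 0 0 * a 1 2 - a 1 0 * a 0 2) * (a 1 1 * a 0 2 - a 1 2 * a 0 1) *
    (a 2 2 * a 0 1 - a 2 1 * a 0 2)
  have ha : ∀ {M N : Mat n}, M * N = 1 → ∀ k l, evalAt M (a k l) = M.det * N (j k) (i l) := by
    intro M N h k l
    rw [evalAt_adjugate, adjugate_eq_of_mul_eq_one h, Matrix.smul_apply, smul_eq_mul]
  refine hasEquation_of_generic (f := f) (N := M₀) (irreducible_signedEq hi hj) (fun M hM => ?_)
    ?_ ?_ fun M hM hf => ?_
  · rw [evalAt_signedEq, signedEq_eq_zero_of_mem_sumSet hi hM]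
  · rw [evalAt_signedEq, signedEq_of_mul_eq_one h₀ hi]
    simp [hN₀]
  · have := det_ne_zero_of_mul_eq_one h₀
    have e1 : M₀.det * 2 * M₀.det - M₀.det * M₀.det = M₀.det * M₀.det := by ring
    simp only [f, evalAt_mul, evalAt_sub, ha h₀, evalAt_det, hN₀]
    simp [e1, this]
  · simp only [f, evalAt_mul, evalAt_det, mul_ne_zero_iff] at hf
    obtain ⟨⟨⟨⟨hdet, h6⟩, hd0⟩, hd1⟩, hd2⟩ := hf
    have h : M * M⁻¹ = 1 := mul_nonsing_inv M (isUnit_iff_ne_zero.2 hdet)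
    simp only [evalAt_sub, evalAt_mul, ha h, mul_ne_zero_iff] at h6 hd0 hd1 hd2
    rw [evalAt_signedEq, signedEq_of_mul_eq_one h hi] at hM
    have hM := (mul_eq_zero.1 hM).resolve_left (pow_ne_zero 2 hdet)
    generalize M⁻¹ = N at *
    obtain ⟨⟨⟨⟨⟨⟨-, h01⟩, ⟨-, h02⟩⟩, ⟨-, h10⟩⟩, ⟨-, h12⟩⟩, ⟨-, h20⟩⟩, ⟨-, h21⟩⟩ := h6
    -- Normalising `u 0 = 1`, five off-diagonal entries determine `u` and `v`; the sixth, at `(2,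
    -- 0)`, then agrees precisely by the equation `hM`.
    refine mem_sumSet_of_rank_one h hi
      (u := ![1, N (j 1) (i 2) / N (j 0) (i 2), N (j 2) (i 1) / N (j 0) (i 1)])
      (v := ![N (j 1) (i 0) * N (j 0) (i 2) / N (j 1) (i 2), N (j 0) (i 1), N (j 0) (i 2)])
      ?_ ?_ ?_
    · intro k l hkl
      fin_cases k <;> fin_cases l <;> first | exact absurd rfl hkl | skip
      · simp
      · simp
      · simp; field_simp
      · simp; field_simp
      · simp; field_simp; linear_combination -hM
      · simp; field_simp
    · intro k hk
      fin_cases k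
      · apply hd0
        simp at hk
        field_simp at hk
        linear_combination M.det ^ 2 * hk
      · apply hd1
        simp at hk
        field_simp at hk
        linear_combination M.det ^ 2 * hk
      · apply hd2
        simp at hk
        field_simp at hk
        linear_combination M.det ^ 2 * hk
    · simp [h10, h02, h12]

end TypeOneEquation

/-! ### The equation of a set of the second type. -/

section CornerEquation

variable {n : ℕ}

theorem irreducible_adjugate (hn : 2 ≤ n) (i j : Fin n) :
    Irreducible ((genericMat n).adjugate j i) :=
  (associated_adjugate_delMinor i j).irreducible (irreducible_delMinor_singleton hn i j)

theorem exists_mul_eq_one_corner {i k a b c : Fin n} (hik : k ≠ i) (hab : a ≠ b) (hac : a ≠ c) :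
    ∃ M N : Mat n, M * N = 1 ∧ N c i = 0 ∧ N c k = 1 ∧
      N a i * N b k - N a k * N b i = 1 := by
  obtain ⟨e, he⟩ := Equiv.Perm.exists_extending_pair ![i, k] ![a, c]
    (by intro x y; fin_cases x <;> fin_cases y <;> simp [hik, hik.symm])
    (by intro x y; fin_cases x <;> fin_cases y <;> simp [hac, hac.symm])
  have hei : e i = a := he 0
  have hek : e k = c := he 1
  -- The permutation alone gives `N b k = 1` when `b = c`; otherwise a unit entry must be added at
  -- `(b, k)`.
  let s : ℂ := if b = c then 0 else 1
  have h1 : (permMat e⁻¹ - single (e⁻¹ b) c s) * (permMat e + single b k s) = 1 := by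
    have e1 : permMat e⁻¹ * single b k s = single (e⁻¹ b) k s := by
      ext x y
      rw [mul_apply, Finset.sum_eq_single b]
      · rw [permMat_apply, single_apply, single_apply]
        simp only [true_and, Equiv.eq_symm_apply, Equiv.Perm.inv_def, Equiv.symm_apply_eq]
        grind
      · intro z _ hz
        rw [single_apply_of_ne _ _ _ _ _ (fun h => hz h.1.symm), mul_zero]
      · simp
    have e2 : single (e⁻¹ b) c s * permMat e = single (e⁻¹ b) k s := by
      ext x y
      rw [mul_apply, Finset.sum_eq_single c]
      · rw [permMat_apply, single_apply, single_apply, ← hek]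
        simp only [e.injective.eq_iff, and_true]
        grind
      · intro z _ hz
        rw [single_apply_of_ne _ _ _ _ _ (fun h => hz h.2.symm), zero_mul]
      · simp
    have e3 : single (e⁻¹ b) c s * single b k s = 0 := by
      by_cases hbc : b = c
      · simp [s, hbc]
      · exact single_mul_single_of_ne _ _ _ _ (Ne.symm hbc) _
    rw [sub_mul, mul_add, mul_add, permMat_inv_mul, e1, e2, e3]
    abel
  refine ⟨_, _, h1, ?_, ?_, ?_⟩
  · simp [permMat_apply, hei, hac.symm, hik]
  · by_cases hbc : b = c <;> simp [permMat_apply, hek, s, hbc]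
  · by_cases hbc : b = c <;>
      simp [permMat_apply, hei, hek, s, hbc, hik, hac, hab.symm]

/-- The cross of row `i` and column `c` contains the three positions, so its cofactor vanishes on
the join. Conversely `N c i = 0` decouples the condition that `B * N` fixes the unit vectors at `i`
and `k`: two equations for row `i` of `B`, one for row `k`. -/
theorem hasEquation_adjugate_of_ne (hn : 2 ≤ n) {i k a b c : Fin n} (hik : k ≠ i) (hab : a ≠ b)
    (hac : a ≠ c) :
    HasEquation (rigJoin (n - 2) {(i, a), (i, b), (k, c)}) ((genericMat n).adjugate c i) := by
  rw [rigJoin_eq]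
  obtain ⟨M₀, N₀, h₀, hN1, hN2, hN3⟩ := exists_mul_eq_one_corner hik hab hac
  let f : Poly n := (genericMat n).det * (genericMat n).adjugate c k *
    cof2 (genericMat n) i k a b
  refine hasEquation_of_generic (f := f) (N := M₀) (irreducible_adjugate hn i c) (fun M hM => ?_)
    ?_ ?_ fun M hM hf => ?_
  · rw [evalAt_adjugate]
    refine adjugate_eq_zero_of_mem_sumSet hn (fun p hp => ?_) hM
    simp only [Finset.mem_insert, Finset.mem_singleton] at hp
    rcases hp with rfl | rfl | rfl
    exacts [Or.inl rfl, Or.inl rfl, Or.inr rfl]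
  · rw [evalAt_adjugate, adjugate_eq_of_mul_eq_one h₀, Matrix.smul_apply, hN1, smul_zero]
  · have := det_ne_zero_of_mul_eq_one h₀
    simp only [f, evalAt_mul, evalAt_det, evalAt_adjugate, evalAt_cof2,
      adjugate_eq_of_mul_eq_one h₀, cof2_of_mul_eq_one h₀ hik.symm, Matrix.smul_apply, hN2, hN3]
    simp [this]
  · simp only [f, evalAt_mul, evalAt_det, mul_ne_zero_iff] at hf
    obtain ⟨⟨hdet, hck⟩, hD⟩ := hf
    have h : M * M⁻¹ = 1 := mul_nonsing_inv M (isUnit_iff_ne_zero.2 hdet)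
    rw [evalAt_adjugate, adjugate_eq_of_mul_eq_one h, Matrix.smul_apply, smul_eq_mul] at hM hck
    rw [evalAt_cof2, cof2_of_mul_eq_one h hik.symm] at hD
    generalize M⁻¹ = N at *
    have hM := (mul_eq_zero.1 hM).resolve_left hdet
    have hck := (mul_ne_zero_iff.1 hck).2
    have hD := (mul_ne_zero_iff.1 hD).2
    set D := N a i * N b k - N a k * N b i with hDdef
    -- Cramer's rule for the two entries in row `i`.
    let B : Mat n := single i a (N b k / D) + single i b (-N a k / D) + single k c (N c k)⁻¹
    have hBz : ∀ x, B *ᵥ x = Pi.single i (N b k / D * x a) + Pi.single i (-N a k / D * x b) +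
        Pi.single k ((N c k)⁻¹ * x c) := fun x => by
      simp only [B, add_mulVec, single_mulVec]
      rfl
    have hNz : ∀ l x, (N *ᵥ Pi.single l 1) x = N x l := fun l x => by simp
    refine ⟨M - B, rank_sub_le_of_mul_eq_one h (x := Pi.single i 1) (y := Pi.single k 1) ?_ ?_ ?_,
      B, fun p hp => ?_, (sub_add_cancel M B).symm⟩
    · rw [LinearIndependent.pair_iff]
      intro s t hst
      have h1 := congrFun hst i
      have h2 := congrFun hst k
      simpa [hik, hik.symm] using And.intro h1 h2
    · rw [hBz, hNz, hNz, hNz, hM, mul_zero, Pi.single_zero, add_zero, ← Pi.single_add]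
      congr 1
      rw [div_mul_eq_mul_div, div_mul_eq_mul_div, ← add_div, div_eq_one_iff_eq hD, hDdef]
      ring
    · rw [hBz, hNz, hNz, hNz, inv_mul_cancel₀ hck, ← Pi.single_add]
      have : N b k / D * N a k + -N a k / D * N b k = 0 := by ring
      rw [this, Pi.single_zero, zero_add]
    · simp only [Finset.mem_insert, Finset.mem_singleton, not_or, Prod.ext_iff] at hp
      simp only [B, Matrix.add_apply]
      rw [single_apply_of_ne _ _ _ _ _ fun h => hp.1 ⟨h.1.symm, h.2.symm⟩,
        single_apply_of_ne _ _ _ _ _ fun h => hp.2.1 ⟨h.1.symm, h.2.symm⟩,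
        single_apply_of_ne _ _ _ _ _ fun h => hp.2.2 ⟨h.1.symm, h.2.symm⟩, add_zero, add_zero]

/-- At most one of `a`, `b` equals `c`, and the two play symmetric roles. -/
theorem hasEquation_adjugate_of_row (hn : 2 ≤ n) {i k a b c : Fin n} (hik : k ≠ i) (hab : a ≠ b) :
    HasEquation (rigJoin (n - 2) {(i, a), (i, b), (k, c)}) ((genericMat n).adjugate c i) := by
  by_cases hac : a = c
  · rw [Finset.insert_comm]
    exact hasEquation_adjugate_of_ne hn hik hab.symm (hac ▸ hab.symm)
  · exact hasEquation_adjugate_of_ne hn hik hab hac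

end CornerEquation

/-! ### Transposition and permutations of rows and columns. -/

section Symmetry

variable {n : ℕ}

theorem image_sumSet (g : Mat n ≃ₗ[ℂ] Mat n) (φ : Equiv.Perm (Fin n × Fin n))
    (hg : ∀ (M : Mat n) (p : Fin n × Fin n), g M (φ p).1 (φ p).2 = M p.1 p.2)
    (hr : ∀ M : Mat n, (g M).rank = M.rank) (r : ℕ) (S : Finset (Fin n × Fin n)) :
    g '' sumSet r S = sumSet r (S.map φ.toEmbedding) := by
  have hg' : ∀ (M : Mat n) (p : Fin n × Fin n), g M p.1 p.2 = M (φ.symm p).1 (φ.symm p).2 :=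
    fun M p => by
      have := hg M (φ.symm p)
      rwa [φ.apply_symm_apply] at this
  ext M
  constructor
  · rintro ⟨_, ⟨A, hA, B, hB, rfl⟩, rfl⟩
    refine ⟨g A, (hr A).trans_le hA, g B, fun p hp => ?_, map_add g A B⟩
    rw [hg']
    exact hB _ fun h => hp (Finset.mem_map_equiv.2 h)
  · rintro ⟨A, hA, B, hB, rfl⟩
    refine ⟨g.symm A + g.symm B, ⟨g.symm A, ?_, g.symm B, fun p hp => ?_, rfl⟩, by simp⟩
    · have := hr (g.symm A)
      rw [g.apply_symm_apply] at this
      exact this.symm.trans_le hA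
    · have := hg (g.symm B) p
      rw [g.apply_symm_apply] at this
      rw [← this]
      exact hB _ fun h => hp (by simpa using h)

theorem image_rigJoin (g : Mat n ≃ₗ[ℂ] Mat n) (φ : Equiv.Perm (Fin n × Fin n))
    (hg : ∀ (M : Mat n) (p : Fin n × Fin n), g M (φ p).1 (φ p).2 = M p.1 p.2)
    (hr : ∀ M : Mat n, (g M).rank = M.rank) (r : ℕ) (S : Finset (Fin n × Fin n)) :
    g '' rigJoin r S = rigJoin r (S.map φ.toEmbedding) := by
  rw [rigJoin_eq, rigJoin_eq, ← zariskiClosure_image, image_sumSet g φ hg hr]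

/-- Transposition as a linear automorphism. -/
def transposeEquiv (n : ℕ) : Mat n ≃ₗ[ℂ] Mat n :=
  transposeLinearEquiv (Fin n) (Fin n) ℂ ℂ

theorem transposeEquiv_apply (M : Mat n) : transposeEquiv n M = Mᵀ :=
  rfl

/-- Permutations of rows and columns as a linear automorphism. -/
def reindexEquiv (σ τ : Equiv.Perm (Fin n)) : Mat n ≃ₗ[ℂ] Mat n :=
  reindexLinearEquiv ℂ ℂ σ τ

theorem reindexEquiv_apply (σ τ : Equiv.Perm (Fin n)) (M : Mat n) :
    reindexEquiv σ τ M = reindex σ τ M :=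
  rfl

theorem image_transpose_rigJoin (r : ℕ) (S : Finset (Fin n × Fin n)) :
    transposeEquiv n '' rigJoin r S =
      rigJoin r (S.map (Equiv.prodComm (Fin n) (Fin n)).toEmbedding) := by
  refine image_rigJoin (transposeEquiv n) (Equiv.prodComm (Fin n) (Fin n)) (fun M p => ?_)
    (fun M => ?_) r S
  · rw [transposeEquiv_apply, transpose_apply]
    rfl
  · rw [transposeEquiv_apply, rank_transpose]

theorem image_reindex_rigJoin (σ τ : Equiv.Perm (Fin n)) (r : ℕ) (S : Finset (Fin n × Fin n)) :
    reindexEquiv σ τ '' rigJoin r S =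
      rigJoin r (S.map (Equiv.prodCongr σ τ).toEmbedding) := by
  refine image_rigJoin (reindexEquiv σ τ) (Equiv.prodCongr σ τ) (fun M p => ?_) (fun M => ?_) r S
  · rw [reindexEquiv_apply, reindex_apply, submatrix_apply]
    simp
  · rw [reindexEquiv_apply, rank_reindex]

end Symmetry

/-! ### The two types of sets and their hypersurfaces. -/

section Types

variable {n : ℕ}

theorem entries_eq_image (i j : Fin 3 → Fin n) :
    entries i j = Finset.univ.image fun k => (i k, j k) := by
  ext p
  simp [entries, Fin.exists_fin_succ, eq_comm]

theorem mem_entries {i j : Fin 3 → Fin n} {p : Fin n × Fin n} :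
    p ∈ entries i j ↔ ∃ k, (i k, j k) = p := by
  simp [entries_eq_image]

theorem entries_comp (i j : Fin 3 → Fin n) (e : Equiv.Perm (Fin 3)) :
    entries (i ∘ e) (j ∘ e) = entries i j := by
  ext p
  rw [mem_entries, mem_entries]
  exact e.exists_congr_left.trans (by simp)

theorem map_entries (i j : Fin 3 → Fin n) (σ τ : Equiv.Perm (Fin n)) :
    (entries i j).map (Equiv.prodCongr σ τ).toEmbedding = entries (σ ∘ i) (τ ∘ j) := by
  simp [entries]

theorem map_prodComm_entries (i j : Fin 3 → Fin n) :
    (entries i j).map (Equiv.prodComm (Fin n) (Fin n)).toEmbedding = entries j i := by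
  simp [entries]

theorem card_entries {i j : Fin 3 → Fin n} (hi : Function.Injective i) :
    (entries i j).card = 3 := by
  rw [entries_eq_image, Finset.card_image_of_injective _ fun k l h => hi (Prod.ext_iff.1 h).1]
  simp

theorem typeOne_iff {S : Finset (Fin n × Fin n)} : TypeOne S ↔
    ∃ i j : Fin 3 → Fin n, Function.Injective i ∧ Function.Injective j ∧ S = entries i j := by
  constructor
  · rintro ⟨hS, hT⟩
    let e := (S.equivFin.trans (finCongr hS)).symm
    have he : Function.Injective fun k => (e k : Fin n × Fin n) :=
      Subtype.val_injective.comp e.injective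
    refine ⟨fun k => (e k : Fin n × Fin n).1, fun k => (e k : Fin n × Fin n).2, fun k l h => ?_,
      fun k l h => ?_, ?_⟩
    · by_contra hkl
      exact (hT _ (e k).2 _ (e l).2 (he.ne hkl)).1 h
    · by_contra hkl
      exact (hT _ (e k).2 _ (e l).2 (he.ne hkl)).2 h
    · ext p
      rw [mem_entries]
      exact ⟨fun hp => ⟨e.symm ⟨p, hp⟩, by simp⟩, by rintro ⟨k, rfl⟩; exact (e k).2⟩
  · rintro ⟨i, j, hi, hj, rfl⟩
    refine ⟨card_entries hi, fun p hp q hq hpq => ?_⟩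
    obtain ⟨k, rfl⟩ := mem_entries.1 hp
    obtain ⟨l, rfl⟩ := mem_entries.1 hq
    have hkl : k ≠ l := fun h => hpq (by rw [h])
    exact ⟨hi.ne hkl, hj.ne hkl⟩

theorem TypeTwo.exists_eq {S : Finset (Fin n × Fin n)} (hS : TypeTwo S) :
    (∃ i k a b c, k ≠ i ∧ a ≠ b ∧ S = {(i, a), (i, b), (k, c)}) ∨
      ∃ j l a b c, l ≠ j ∧ a ≠ b ∧ S = {(a, j), (b, j), (c, l)} := by
  obtain ⟨hcard, hT, hC⟩ := hS
  simp only [Transversal, not_forall] at hT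
  obtain ⟨p, hp, q, hq, hpq, h⟩ := hT
  have h1 : ((S.erase p).erase q).card = 1 := by
    rw [Finset.card_erase_of_mem (Finset.mem_erase.2 ⟨hpq.symm, hq⟩),
      Finset.card_erase_of_mem hp, hcard]
  obtain ⟨r, hr⟩ := Finset.card_eq_one.1 h1
  have hS : S = {p, q, r} := by
    rw [← hr, Finset.insert_erase (Finset.mem_erase.2 ⟨hpq.symm, hq⟩), Finset.insert_erase hp]
  have hC1 : ¬ (p.1 = q.1 ∧ r.1 = q.1) := fun h => hC (Or.inl ⟨q.1, by simp [hS, h]⟩)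
  have hC2 : ¬ (p.2 = q.2 ∧ r.2 = q.2) := fun h => hC (Or.inr ⟨q.2, by simp [hS, h]⟩)
  obtain ⟨p1, p2⟩ := p
  obtain ⟨q1, q2⟩ := q
  obtain ⟨r1, r2⟩ := r
  by_cases h2 : p1 = q1
  · subst h2
    exact Or.inl ⟨p1, r1, p2, q2, r2, fun h => hC1 ⟨rfl, h⟩, fun h => hpq (by rw [h]), hS⟩
  · have h3 : p2 = q2 := by simpa [h2] using h
    subst h3
    exact Or.inr ⟨p2, r2, p1, q1, r1, fun h => hC2 ⟨rfl, h⟩, h2, hS⟩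

theorem typeTwo_of_row {i k a b c : Fin n} (hik : k ≠ i) (hab : a ≠ b) :
    TypeTwo {(i, a), (i, b), (k, c)} := by
  refine ⟨?_, fun h => ?_, fun h => ?_⟩
  · rw [Finset.card_eq_three]
    exact ⟨_, _, _, by simp [hab], by simp [hik.symm], by simp [hik.symm], rfl⟩
  · exact (h (i, a) (by simp) (i, b) (by simp) (by simp [hab])).1 rfl
  · rcases h with ⟨x, hx⟩ | ⟨x, hx⟩
    · exact hik ((hx (k, c) (by simp)).trans (hx (i, a) (by simp)).symm)
    · exact hab ((hx (i, a) (by simp)).trans (hx (i, b) (by simp)).symm)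

theorem hasEquation_adjugate_transpose {S : Finset (Fin n × Fin n)} {r : ℕ} {i c : Fin n}
    (h : HasEquation (rigJoin r S) ((genericMat n).adjugate c i)) :
    HasEquation (rigJoin r (S.map (Equiv.prodComm (Fin n) (Fin n)).toEmbedding))
      ((genericMat n).adjugate i c) := by
  rw [← image_transpose_rigJoin]
  convert h.image (transposeEquiv n) using 1
  refine poly_ext fun M => ?_
  rw [evalAt_pullback, evalAt_adjugate, evalAt_adjugate]
  change _ = (Mᵀ).adjugate c i
  rw [← adjugate_transpose, transpose_apply]

/-- For a set of the second type there is exactly one row and column that contain it, and the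
corresponding cofactor is the equation. -/
theorem TypeTwo.exists_corner (hn : 2 ≤ n) {S : Finset (Fin n × Fin n)} (hS : TypeTwo S) :
    ∃ i c, HasEquation (rigJoin (n - 2) S) ((genericMat n).adjugate c i) ∧
      ∀ i' c', (∀ p ∈ S, p.1 = i' ∨ p.2 = c') ↔ i' = i ∧ c' = c := by
  rcases hS.exists_eq with ⟨i, k, a, b, c, hik, hab, rfl⟩ | ⟨j, l, a, b, c, hjl, hab, rfl⟩
  · refine ⟨i, c, hasEquation_adjugate_of_row hn hik hab, fun i' c' => ?_⟩
    simp only [Finset.mem_insert, Finset.mem_singleton, forall_eq_or_imp, forall_eq]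
    grind
  · refine ⟨c, j, ?_, fun i' c' => ?_⟩
    · have := hasEquation_adjugate_transpose (hasEquation_adjugate_of_row hn (c := c) hjl hab)
      simpa using this
    · simp only [Finset.mem_insert, Finset.mem_singleton, forall_eq_or_imp, forall_eq]
      grind

/-- The corner with one more entry in its row and one in its column. Thus every cofactor occurs as
an equation, which serves both the count and the absorption of collinear sets. -/
theorem exists_typeTwo (hn : 2 ≤ n) (i c : Fin n) : ∃ S : Finset (Fin n × Fin n), TypeTwo S ∧
    (∀ p ∈ S, p.1 = i ∨ p.2 = c) ∧
    HasEquation (rigJoin (n - 2) S) ((genericMat n).adjugate c i) := by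
  have : Nontrivial (Fin n) := Fin.nontrivial_iff_two_le.2 hn
  obtain ⟨k, hk⟩ := exists_ne i
  obtain ⟨b, hb⟩ := exists_ne c
  refine ⟨{(i, c), (i, b), (k, c)}, typeTwo_of_row hk hb.symm, ?_,
    hasEquation_adjugate_of_row hn hk hb.symm⟩
  simp

theorem HasEquation.delMinor_of_adjugate {X : Set (Mat n)} {i c : Fin n}
    (h : HasEquation X ((genericMat n).adjugate c i)) : HasEquation X (delMinor {i} {c}) :=
  h.congr (associated_adjugate_delMinor i c).symm

theorem HasEquation.twoTermEq_of_signedEq {X : Set (Mat n)} {i j : Fin 3 → Fin n}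
    (hi : Function.Injective i) (hj : Function.Injective j)
    (h : HasEquation X (signedEq (genericMat n) i j)) :
    HasEquation X (twoTermEq (labelSign i j) i j) :=
  h.congr (associated_twoTermEq hi hj).symm

theorem hasEquation_twoTermEq {i j : Fin 3 → Fin n} (hi : Function.Injective i)
    (hj : Function.Injective j) :
    HasEquation (rigJoin (n - 2) (entries i j)) (twoTermEq (labelSign i j) i j) :=
  (hasEquation_signedEq hi hj).twoTermEq_of_signedEq hi hj

theorem twoTermEq_ne_zero {i j : Fin 3 → Fin n} (hi : Function.Injective i)
    (hj : Function.Injective j) : twoTermEq (labelSign i j) i j ≠ 0 :=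
  ((associated_twoTermEq hi hj).ne_zero_iff).2 (irreducible_signedEq hi hj).ne_zero

theorem isHypersurfaceOfDegree_of_typeOne {S : Finset (Fin n × Fin n)} (hS : TypeOne S) :
    IsHypersurfaceOfDegree (rigJoin (n - 2) S) (2 * n - 3) := by
  obtain ⟨i, j, hi, hj, rfl⟩ := typeOne_iff.1 hS
  have hn := three_le_of_injective hi
  exact (hasEquation_twoTermEq hi hj).isHypersurfaceOfDegree (isZariskiClosed_rigJoin _ _)
    (twoTermEq_ne_zero hi hj) (isHomogeneous_twoTermEq (by omega) _ hi hj) (by omega)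

theorem isHypersurfaceOfDegree_of_typeTwo (hn : 2 ≤ n) {S : Finset (Fin n × Fin n)}
    (hS : TypeTwo S) : IsHypersurfaceOfDegree (rigJoin (n - 2) S) (n - 1) := by
  obtain ⟨i, c, h, -⟩ := hS.exists_corner hn
  exact h.delMinor_of_adjugate.isHypersurfaceOfDegree (isZariskiClosed_rigJoin _ _)
    (irreducible_delMinor_singleton hn i c).ne_zero (isHomogeneous_delMinor_singleton i c)
    (by omega)

theorem exists_irreducible_hasEquation (hn : 2 ≤ n) {S : Finset (Fin n × Fin n)}
    (hS : TypeOne S ∨ TypeTwo S) :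
    ∃ P : Poly n, Irreducible P ∧ HasEquation (rigJoin (n - 2) S) P := by
  rcases hS with hS | hS
  · obtain ⟨i, j, hi, hj, rfl⟩ := typeOne_iff.1 hS
    exact ⟨_, irreducible_signedEq hi hj, hasEquation_signedEq hi hj⟩
  · obtain ⟨i, c, h, -⟩ := hS.exists_corner hn
    exact ⟨_, irreducible_adjugate hn i c, h⟩

theorem eq_of_isHypersurfaceOfDegree {X : Set (Mat n)} {d d' : ℕ}
    (h : IsHypersurfaceOfDegree X d) (h' : IsHypersurfaceOfDegree X d') : d = d' := by
  obtain ⟨-, P, hP, rfl⟩ := h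
  obtain ⟨-, Q, hQ, rfl⟩ := h'
  exact totalDegree_eq_of_associated (hQ.associated hP)

end Types

/-! ### Irreducible components. -/

section Components

variable {n : ℕ}

theorem rig_le_of_mem_sumSet {r s : ℕ} {S : Finset (Fin n × Fin n)} (hS : S.card ≤ s) {M : Mat n}
    (hM : M ∈ sumSet r S) : rig r M ≤ s := by
  obtain ⟨A, hA, B, hB, rfl⟩ := hM
  have h : rig r (A + B) ≤ Set.ncard {p : Fin n × Fin n | B p.1 p.2 ≠ 0} :=
    Nat.sInf_le ⟨A, hA, B, rfl, rfl⟩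
  refine h.trans (le_trans ?_ hS)
  rw [← Set.ncard_coe_finset S]
  refine Set.ncard_le_ncard (fun p hp => ?_) S.finite_toSet
  by_contra h
  exact hp (hB p h)

theorem rigJoin_subset_borderRig {r s : ℕ} {S : Finset (Fin n × Fin n)} (hS : S.card ≤ s) :
    rigJoin r S ⊆ borderRig n r s := by
  rw [rigJoin_eq]
  exact zariskiClosure_subset isZariskiClosed_zariskiClosure fun M hM =>
    subset_zariskiClosure (rig_le_of_mem_sumSet hS hM)

theorem exists_mem_sumSet_of_rig_le {r s : ℕ} (hs : s ≤ n * n) {M : Mat n} (hM : rig r M ≤ s) :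
    ∃ S : Finset (Fin n × Fin n), S.card = s ∧ M ∈ sumSet r S := by
  -- The infimum is attained because `M = 0 + M` is always a decomposition.
  have h : rig r M ∈ {s : ℕ | ∃ A ∈ rankLE n r, ∃ B : Mat n, M = A + B ∧
      Set.ncard {p : Fin n × Fin n | B p.1 p.2 ≠ 0} = s} :=
    Nat.sInf_mem ⟨_, 0, by simp [rankLE], M, (zero_add M).symm, rfl⟩
  obtain ⟨A, hA, B, hAB, hB⟩ := h
  obtain ⟨S, hS, hcard⟩ := Finset.exists_superset_card_eq
    (s := Finset.univ.filter fun p : Fin n × Fin n => B p.1 p.2 ≠ 0) (n := s)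
    (by rw [← Set.ncard_coe_finset]; simpa [hB] using hM) (by simpa using hs)
  refine ⟨S, hcard, A, hA, B, fun p hp => ?_, hAB⟩
  by_contra h
  exact hp (hS (by simpa using h))

/-- A set in one row or one column gives a variety in which the cofactors of this row or column
vanish. -/
theorem Collinear.exists_adjugate_eq_zero (hn : 2 ≤ n) {S : Finset (Fin n × Fin n)}
    (hS : Collinear S) : ∃ i c, ∀ M ∈ sumSet (n - 2) S, M.adjugate c i = 0 := by
  rcases hS with ⟨i, hi⟩ | ⟨c, hc⟩
  · exact ⟨i, i, fun M hM => adjugate_eq_zero_of_mem_sumSet hn (fun p hp => Or.inl (hi p hp)) hM⟩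
  · exact ⟨c, c, fun M hM => adjugate_eq_zero_of_mem_sumSet hn (fun p hp => Or.inr (hc p hp)) hM⟩

/-- The support can be enlarged to exactly three entries since `3 ≤ n * n`. If it is collinear, some
cofactor vanishes at `M`, and this cofactor is the equation of a set of the second type. -/
theorem exists_mem_rigJoin_of_rig_le (hn : 2 ≤ n) {M : Mat n} (hM : rig (n - 2) M ≤ 3) :
    ∃ S : Finset (Fin n × Fin n), (TypeOne S ∨ TypeTwo S) ∧ M ∈ rigJoin (n - 2) S := by
  obtain ⟨S, hS, hMS⟩ := exists_mem_sumSet_of_rig_le (by nlinarith) hM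
  by_cases hC : Collinear S
  · obtain ⟨i, c, h⟩ := hC.exists_adjugate_eq_zero hn
    obtain ⟨T, hT, -, hE⟩ := exists_typeTwo hn i c
    refine ⟨T, Or.inr hT, (hE.mem_iff (isZariskiClosed_rigJoin _ _)).2 ?_⟩
    rw [evalAt_adjugate, h M hMS]
  · refine ⟨S, ?_, ?_⟩
    · by_cases hT : Transversal S
      · exact Or.inl ⟨hS, hT⟩
      · exact Or.inr ⟨hS, hT, hC⟩
    · rw [rigJoin_eq]
      exact subset_zariskiClosure hMS

/-- The product of all the equations vanishes on the matrices of rigidity at most three, hence on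
the closure and on `X`; the prime ideal of `X` contains one factor. -/
theorem exists_subset_rigJoin (hn : 2 ≤ n) {X : Set (Mat n)} (hX : IsIrredVariety X)
    (hXV : X ⊆ borderRig n (n - 2) 3) :
    ∃ S : Finset (Fin n × Fin n), (TypeOne S ∨ TypeTwo S) ∧ X ⊆ rigJoin (n - 2) S := by
  classical
  have h : ∀ S : Finset (Fin n × Fin n), ∃ P : Poly n, (TypeOne S ∨ TypeTwo S) →
      HasEquation (rigJoin (n - 2) S) P := by
    intro S
    by_cases hS : TypeOne S ∨ TypeTwo S
    · obtain ⟨P, -, hP⟩ := exists_irreducible_hasEquation hn hS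
      exact ⟨P, fun _ => hP⟩
    · exact ⟨0, fun h => absurd h hS⟩
  choose P hP using h
  have hprime := isPrime_of_isIrredVariety hX
  have hprod : ∏ S ∈ Finset.univ.filter (fun S : Finset (Fin n × Fin n) => TypeOne S ∨ TypeTwo S),
      P S ∈ idealOf X := by
    refine mem_idealOf.2 fun M hM => hXV hM _ (mem_idealOf.2 fun M hM => ?_)
    obtain ⟨S, hS, hMS⟩ := exists_mem_rigJoin_of_rig_le hn hM
    rw [evalAt_prod]
    exact Finset.prod_eq_zero (Finset.mem_filter.2 ⟨Finset.mem_univ S, hS⟩)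
      (((hP S hS).mem_iff (isZariskiClosed_rigJoin _ _)).1 hMS)
  obtain ⟨S, hS, hPS⟩ := Ideal.IsPrime.prod_mem_iff.1 hprod
  have hS := (Finset.mem_filter.1 hS).2
  exact ⟨S, hS, fun M hM =>
    ((hP S hS).mem_iff (isZariskiClosed_rigJoin _ _)).2 (mem_idealOf.1 hPS M hM)⟩

theorem isComponent_iff (hn : 2 ≤ n) (X : Set (Mat n)) : IsComponent (borderRig n (n - 2) 3) X ↔
    ∃ S : Finset (Fin n × Fin n), (TypeOne S ∨ TypeTwo S) ∧ X = rigJoin (n - 2) S := by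
  have hcard : ∀ S : Finset (Fin n × Fin n), TypeOne S ∨ TypeTwo S → S.card ≤ 3 := by
    rintro S (h | h)
    exacts [h.1.le, h.1.le]
  have hirr : ∀ S : Finset (Fin n × Fin n), TypeOne S ∨ TypeTwo S →
      IsIrredVariety (rigJoin (n - 2) S) := fun S hS => by
    obtain ⟨P, hPi, hP⟩ := exists_irreducible_hasEquation hn hS
    exact hP.isIrredVariety hPi (isZariskiClosed_rigJoin _ _)
  constructor
  · intro hX
    obtain ⟨S, hS, hXS⟩ := exists_subset_rigJoin hn hX.prop.1 hX.prop.2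
    exact ⟨S, hS, hX.eq_of_subset ⟨hirr S hS, rigJoin_subset_borderRig (hcard S hS)⟩ hXS⟩
  · rintro ⟨S, hS, rfl⟩
    refine ⟨⟨hirr S hS, rigJoin_subset_borderRig (hcard S hS)⟩, fun Y hY hSY => ?_⟩
    obtain ⟨T, hT, hYT⟩ := exists_subset_rigJoin hn hY.1 hY.2
    obtain ⟨P, hPi, hP⟩ := exists_irreducible_hasEquation hn hS
    obtain ⟨Q, hQi, hQ⟩ := exists_irreducible_hasEquation hn hT
    have := hP.eq_of_subset hQ (isZariskiClosed_rigJoin _ _) hQi hPi (isZariskiClosed_rigJoin _ _)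
      (hSY.trans hYT)
    rw [this]
    exact hYT

end Components

/-! ### Linear isomorphism classes. -/

section LinearIsomorphism

variable {n : ℕ}

theorem linIso_of_typeOne {S T : Finset (Fin n × Fin n)} (hS : TypeOne S) (hT : TypeOne T) (r : ℕ) :
    LinIso (rigJoin r S) (rigJoin r T) := by
  obtain ⟨i, j, hi, hj, rfl⟩ := typeOne_iff.1 hS
  obtain ⟨i', j', hi', hj', rfl⟩ := typeOne_iff.1 hT
  obtain ⟨σ, hσ⟩ := exists_perm_eq hi hi'
  obtain ⟨τ, hτ⟩ := exists_perm_eq hj hj'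
  refine ⟨reindexEquiv σ τ, ?_⟩
  rw [image_reindex_rigJoin, map_entries, show σ ∘ i = i' from funext hσ,
    show τ ∘ j = j' from funext hτ]

/-- The sets themselves need not be related by row and column permutations, but each join depends
only on its corner, so `S` and `T` may be replaced by standard sets at these corners. -/
theorem linIso_of_typeTwo (hn : 2 ≤ n) {S T : Finset (Fin n × Fin n)} (hS : TypeTwo S)
    (hT : TypeTwo T) : LinIso (rigJoin (n - 2) S) (rigJoin (n - 2) T) := by
  obtain ⟨i, c, hE, -⟩ := hS.exists_corner hn
  obtain ⟨i', c', hE', -⟩ := hT.exists_corner hn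
  have : Nontrivial (Fin n) := Fin.nontrivial_iff_two_le.2 hn
  obtain ⟨k, hk⟩ := exists_ne i
  obtain ⟨b, hb⟩ := exists_ne c
  have h1 := hasEquation_adjugate_of_row hn (c := c) hk hb.symm
  have hσ : Equiv.swap i i' k ≠ i' := fun h =>
    hk ((Equiv.swap i i').injective (h.trans (Equiv.swap_apply_left i i').symm))
  have hτ : c' ≠ Equiv.swap c c' b := fun h =>
    hb ((Equiv.swap c c').injective (h.symm.trans (Equiv.swap_apply_left c c').symm))
  have h2 := hasEquation_adjugate_of_row hn (c := c') hσ hτ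
  refine ⟨reindexEquiv (Equiv.swap i i') (Equiv.swap c c'), ?_⟩
  rw [hE.eq h1 (isZariskiClosed_rigJoin _ _) (isZariskiClosed_rigJoin _ _),
    hE'.eq h2 (isZariskiClosed_rigJoin _ _) (isZariskiClosed_rigJoin _ _), image_reindex_rigJoin]
  simp

/-- A linear isomorphism would make a polynomial of degree `2 * n - 3` divide a nonzero one of
degree `n - 1`, impossible since a transversal set forces `n ≥ 3`. -/
theorem not_linIso {S T : Finset (Fin n × Fin n)} (hS : TypeOne S)
    (hT : TypeTwo T) : ¬ LinIso (rigJoin (n - 2) S) (rigJoin (n - 2) T) := by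
  obtain ⟨i, j, hi, hj, rfl⟩ := typeOne_iff.1 hS
  have hn := three_le_of_injective hi
  obtain ⟨a, c, hE, -⟩ := hT.exists_corner (by omega)
  have hE := hE.delMinor_of_adjugate
  rintro ⟨g, hg⟩
  have h1 := hasEquation_twoTermEq hi hj
  have h2 : pullback (g : Mat n →ₗ[ℂ] Mat n) (delMinor {a} {c}) ∈
      idealOf (rigJoin (n - 2) (entries i j)) := by
    rw [← mem_idealOf_image, LinearEquiv.coe_coe, hg, hE]
    exact Ideal.mem_span_singleton_self _
  rw [h1, Ideal.mem_span_singleton] at h2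
  have h3 : pullback (g : Mat n →ₗ[ℂ] Mat n) (delMinor {a} {c}) ≠ 0 := by
    intro h
    refine (irreducible_delMinor_singleton (by omega) a c).ne_zero (poly_ext fun M => ?_)
    have := evalAt_pullback (g : Mat n →ₗ[ℂ] Mat n) (g.symm M) (delMinor {a} {c})
    rw [h, evalAt_zero, LinearEquiv.coe_coe, g.apply_symm_apply] at this
    rw [← this, evalAt_zero]
  have h4 := MvPolynomial.totalDegree_le_of_dvd_of_isDomain h2 h3
  rw [(isHomogeneous_twoTermEq (by omega) _ hi hj).totalDegree (twoTermEq_ne_zero hi hj),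
    (isHomogeneous_pullback (g : Mat n →ₗ[ℂ] Mat n)
      (isHomogeneous_delMinor_singleton a c)).totalDegree h3] at h4
  omega

end LinearIsomorphism

/-! ### Numbers of components. -/

section Counting

variable {n : ℕ}

theorem exists_forall_evalAt_eq {P Q : Poly n} (h : Associated P Q) :
    ∃ c : ℂ, c ≠ 0 ∧ ∀ M, evalAt M Q = c * evalAt M P := by
  obtain ⟨c, hc, rfl⟩ := exists_C_of_associated h
  exact ⟨c, hc, fun M => by rw [evalAt_mul, evalAt_C]⟩

theorem exists_evalAt_ne_zero {P : Poly n} (h : P ≠ 0) : ∃ M, evalAt M P ≠ 0 := by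
  by_contra! H
  exact h (poly_ext fun M => by rw [H M, evalAt_zero])

/-- The two equations are proportional. Doubling row `r` multiplies each by `2` or by `4`, according
to whether `r` is one of its rows. -/
theorem rows_eq_of_rigJoin_eq {i j i' j' : Fin 3 → Fin n} (hi : Function.Injective i)
    (hj : Function.Injective j) (hi' : Function.Injective i') (hj' : Function.Injective j')
    (h : rigJoin (n - 2) (entries i j) = rigJoin (n - 2) (entries i' j')) (r : Fin n) :
    (∃ k, i k = r) ↔ ∃ k, i' k = r := by
  have h1 := hasEquation_signedEq hi hj
  have h2 := hasEquation_signedEq hi' hj'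
  rw [← h] at h2
  obtain ⟨c, hc, hcM⟩ := exists_forall_evalAt_eq (h1.associated h2)
  simp only [evalAt_signedEq] at hcM
  obtain ⟨M, hM⟩ := exists_evalAt_ne_zero (irreducible_signedEq hi hj).ne_zero
  rw [evalAt_signedEq] at hM
  have h3 := hcM (M.updateRow r ((2 : ℂ) • M r))
  rw [signedEq_updateRow_smul _ _ hi, signedEq_updateRow_smul _ _ hi', hcM M] at h3
  have h4 : (if ∃ k, i' k = r then (2 : ℂ) else 2 ^ 2) =
      if ∃ k, i k = r then (2 : ℂ) else 2 ^ 2 := by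
    apply mul_right_cancel₀ (mul_ne_zero hc hM)
    linear_combination h3
  by_cases ha : ∃ k, i k = r <;> by_cases hb : ∃ k, i' k = r <;>
    simp only [ha, hb, if_true, if_false] at h4 ⊢
  · norm_num at h4
  · norm_num at h4

/-- Within the 3 by 3 block, the equation genuinely involves every variable off `S`: relabelling
moves such a position to `(i 0, j 1)`, where the linear coefficient is a nonzero polynomial. -/
theorem mem_entries_of_rigJoin_eq {i j : Fin 3 → Fin n} (hi : Function.Injective i)
    (hj : Function.Injective j) {S : Finset (Fin n × Fin n)} {P : Poly n}
    (hP : HasEquation (rigJoin (n - 2) S) P)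
    (hS : rigJoin (n - 2) (entries i j) = rigJoin (n - 2) S) {p : Fin n × Fin n}
    (hp : ∀ (M : Mat n) (t : ℂ), evalAt (M + single p.1 p.2 t) P = evalAt M P)
    {a b : Fin 3} (ha : i a = p.1) (hb : j b = p.2) : p ∈ entries i j := by
  by_contra hne
  have hn := three_le_of_injective hi
  have hab : a ≠ b := by
    rintro rfl
    exact hne (mem_entries.2 ⟨a, Prod.ext ha hb⟩)
  obtain ⟨e, he⟩ := Equiv.Perm.exists_extending_pair ![(0 : Fin 3), 1] ![a, b]
    (by decide) (by intro x y; fin_cases x <;> fin_cases y <;> simp [hab, hab.symm])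
  have he0 : e 0 = a := he 0
  have he1 : e 1 = b := he 1
  have hi' := hi.comp e.injective
  have hj' := hj.comp e.injective
  have h1 := hasEquation_signedEq hi' hj'
  rw [entries_comp, hS] at h1
  obtain ⟨c, -, hcM⟩ := exists_forall_evalAt_eq (hP.associated h1)
  have hi01 := hi'.ne (by decide : (0 : Fin 3) ≠ 1)
  have hi02 := hi'.ne (by decide : (0 : Fin 3) ≠ 2)
  have hj01 := hj'.ne (by decide : (0 : Fin 3) ≠ 1)
  have hj12 := hj'.ne (by decide : (1 : Fin 3) ≠ 2)
  have h0 : cof2 (genericMat n) ((i ∘ e) 1) ((i ∘ e) 0) ((j ∘ e) 2) ((j ∘ e) 1) *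
      cof2 (genericMat n) ((i ∘ e) 0) ((i ∘ e) 2) ((j ∘ e) 0) ((j ∘ e) 1) ≠ 0 :=
    mul_ne_zero
      ((associated_cof2_delMinor hi01.symm hj12.symm).irreducible
        (irreducible_delMinor_pair hn hi01.symm hj12.symm)).ne_zero
      ((associated_cof2_delMinor hi02 hj01).irreducible
        (irreducible_delMinor_pair hn hi02 hj01)).ne_zero
  obtain ⟨M, hM⟩ := exists_evalAt_ne_zero h0
  rw [evalAt_mul, evalAt_cof2, evalAt_cof2] at hM
  have h2 := hcM (M + single p.1 p.2 1)
  rw [hp, ← hcM, evalAt_signedEq, evalAt_signedEq] at h2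
  have hp1 : p.1 = (i ∘ e) 0 := by rw [Function.comp_apply, he0, ha]
  have hp2 : p.2 = (j ∘ e) 1 := by rw [Function.comp_apply, he1, hb]
  rw [hp1, hp2, signedEq_add_single_zero_one _ hi'] at h2
  apply hM
  linear_combination -h2

theorem rigJoin_injOn_typeOne :
    Set.InjOn (rigJoin (n - 2)) {S : Finset (Fin n × Fin n) | TypeOne S} := by
  intro T hT S hS hTS
  obtain ⟨i', j', hi', hj', rfl⟩ := typeOne_iff.1 hT
  obtain ⟨i, j, hi, hj, rfl⟩ := typeOne_iff.1 hS
  have hcols := congrArg (transposeEquiv n '' ·) hTS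
  simp only [image_transpose_rigJoin, map_prodComm_entries] at hcols
  refine Finset.eq_of_subset_of_card_le (fun p hp => ?_)
    ((card_entries hi).trans (card_entries hi').symm).le
  obtain ⟨k, rfl⟩ := mem_entries.1 hp
  obtain ⟨a, ha⟩ := (rows_eq_of_rigJoin_eq hi' hj' hi hj hTS (i' k)).1 ⟨k, rfl⟩
  obtain ⟨b, hb⟩ := (rows_eq_of_rigJoin_eq hj' hi' hj hi hcols (j' k)).1 ⟨k, rfl⟩
  refine mem_entries_of_rigJoin_eq hi hj (hasEquation_signedEq hi' hj') hTS.symm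
    (fun M t => ?_) ha hb
  rw [evalAt_signedEq, evalAt_signedEq, signedEq_add_single M hi']

/-- The transversal set given by a set of three rows and an injective choice of columns. -/
def transversalOf (p : {I : Finset (Fin n) // I.card = 3} × (Fin 3 ↪ Fin n)) :
    Finset (Fin n × Fin n) :=
  entries (p.1.1.orderEmbOfFin p.1.2) p.2

theorem transversalOf_injective : Function.Injective (transversalOf (n := n)) := by
  rintro ⟨⟨I, hI⟩, j⟩ ⟨⟨I', hI'⟩, j'⟩ h
  have key : ∀ (I : Finset (Fin n)) (hI : I.card = 3) (j : Fin 3 ↪ Fin n),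
      (transversalOf (⟨I, hI⟩, j)).image Prod.fst = I := by
    intro I hI j
    ext x
    simp only [transversalOf, entries_eq_image, Finset.image_image, Finset.mem_image,
      Finset.mem_univ, true_and, Function.comp_apply]
    have := Finset.range_orderEmbOfFin I hI
    exact (Set.ext_iff.1 this x)
  have hII : I = I' := by rw [← key I hI j, ← key I' hI' j', h]
  subst hII
  congr 1
  ext k : 1
  have h1 : (I.orderEmbOfFin hI k, j k) ∈ transversalOf (⟨I, hI'⟩, j') := by
    rw [← h]
    exact mem_entries.2 ⟨k, rfl⟩
  obtain ⟨l, hl⟩ := mem_entries.1 h1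
  obtain ⟨hl1, hl2⟩ := Prod.ext_iff.1 hl
  have hlk : l = k := (I.orderEmbOfFin hI).injective hl1
  have hjl : j' l = j k := hl2
  rw [← hjl, hlk]

theorem range_transversalOf :
    Set.range (transversalOf (n := n)) = {S : Finset (Fin n × Fin n) | TypeOne S} := by
  ext S
  constructor
  · rintro ⟨⟨⟨I, hI⟩, j⟩, rfl⟩
    exact typeOne_iff.2 ⟨_, _, (I.orderEmbOfFin hI).injective, j.injective, rfl⟩
  · intro hS
    obtain ⟨i, j, hi, hj, rfl⟩ := typeOne_iff.1 hS
    have hI : (Finset.univ.image i).card = 3 := by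
      rw [Finset.card_image_of_injective _ hi]; simp
    have h1 : ∀ k, ∃ l, i l = (Finset.univ.image i).orderEmbOfFin hI k := fun k => by
      obtain ⟨l, -, hl⟩ := Finset.mem_image.1 (Finset.orderEmbOfFin_mem (Finset.univ.image i) hI k)
      exact ⟨l, hl⟩
    choose m hm using h1
    have hmi : Function.Injective m := fun k l h =>
      ((Finset.univ.image i).orderEmbOfFin hI).injective (by rw [← hm, ← hm, h])
    let e : Equiv.Perm (Fin 3) := Equiv.ofBijective m (Finite.injective_iff_bijective.1 hmi)
    refine ⟨⟨⟨Finset.univ.image i, hI⟩, ⟨j ∘ e, hj.comp e.injective⟩⟩, ?_⟩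
    rw [← entries_comp i j e, transversalOf]
    congr 1
    exact (funext hm).symm

theorem ncard_typeOne :
    Set.ncard {S : Finset (Fin n × Fin n) | TypeOne S} = 6 * (n.choose 3) ^ 2 := by
  rw [← range_transversalOf, ← Set.image_univ,
    Set.ncard_image_of_injective _ transversalOf_injective, Set.ncard_univ, Nat.card_eq_fintype_card, Fintype.card_prod, Fintype.card_finset_len,
    Fintype.card_embedding_eq, Nat.descFactorial_eq_factorial_mul_choose]
  simp [Nat.factorial]
  ring

theorem ncard_components_typeOne (hn : 2 ≤ n) :
    Set.ncard {X : Set (Mat n) | IsComponent (borderRig n (n - 2) 3) X ∧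
      ∃ S : Finset (Fin n × Fin n), TypeOne S ∧ X = rigJoin (n - 2) S} = 6 * (n.choose 3) ^ 2 := by
  rw [← ncard_typeOne, ← rigJoin_injOn_typeOne.ncard_image]
  congr 1
  ext X
  constructor
  · rintro ⟨-, S, hS, rfl⟩
    exact ⟨S, hS, rfl⟩
  · rintro ⟨S, hS, rfl⟩
    exact ⟨(isComponent_iff hn _).2 ⟨S, Or.inl hS, rfl⟩, S, hS, rfl⟩

theorem row_eq_of_adjugate_eq (hn : 2 ≤ n) {i c i' c' : Fin n} {z : ℂ} (hz : z ≠ 0)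
    (h : ∀ M : Mat n, M.adjugate c' i' = z * M.adjugate c i) : i = i' := by
  obtain ⟨M, hM⟩ := exists_evalAt_ne_zero (irreducible_adjugate hn i c).ne_zero
  rw [evalAt_adjugate] at hM
  have h1 := h (M.updateRow i ((2 : ℂ) • M i))
  rw [adjugate_updateRow_smul, adjugate_updateRow_smul, if_pos rfl, h] at h1
  by_contra hne
  rw [if_neg (Ne.symm hne)] at h1
  apply mul_ne_zero hz hM
  linear_combination h1

theorem zeros_adjugate_injective (hn : 2 ≤ n) : Function.Injective
    fun p : Fin n × Fin n => {M : Mat n | M.adjugate p.2 p.1 = 0} := by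
  rintro ⟨i, c⟩ ⟨i', c'⟩ h
  have key : ∀ i c : Fin n,
      HasEquation {M : Mat n | M.adjugate c i = 0} ((genericMat n).adjugate c i) := by
    intro i c
    obtain ⟨S, -, -, hE⟩ := exists_typeTwo hn i c
    convert hE using 1
    ext M
    rw [hE.mem_iff (isZariskiClosed_rigJoin _ _), evalAt_adjugate]
    rfl
  have h1 := key i c
  have h2 := key i' c'
  simp only at h
  rw [← h] at h2
  obtain ⟨z, hz, hzM⟩ := exists_forall_evalAt_eq (h1.associated h2)
  simp only [evalAt_adjugate] at hzM
  refine Prod.ext (row_eq_of_adjugate_eq hn hz hzM) (row_eq_of_adjugate_eq hn hz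
    (i := c) (c := i) (i' := c') (c' := i') fun M => ?_)
  have := hzM Mᵀ
  rwa [← adjugate_transpose, transpose_apply, transpose_apply] at this

theorem ncard_components_typeTwo (hn : 2 ≤ n) :
    Set.ncard {X : Set (Mat n) | IsComponent (borderRig n (n - 2) 3) X ∧
      ∃ S : Finset (Fin n × Fin n), TypeTwo S ∧ X = rigJoin (n - 2) S} = n ^ 2 := by
  have hzeros : ∀ {S : Finset (Fin n × Fin n)} {i c : Fin n},
      HasEquation (rigJoin (n - 2) S) ((genericMat n).adjugate c i) →
        {M : Mat n | M.adjugate c i = 0} = rigJoin (n - 2) S := by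
    intro S i c hE
    ext M
    rw [hE.mem_iff (isZariskiClosed_rigJoin _ _), evalAt_adjugate]
    rfl
  have : {X : Set (Mat n) | IsComponent (borderRig n (n - 2) 3) X ∧
      ∃ S : Finset (Fin n × Fin n), TypeTwo S ∧ X = rigJoin (n - 2) S} =
      (fun p : Fin n × Fin n => {M : Mat n | M.adjugate p.2 p.1 = 0}) '' Set.univ := by
    ext X
    constructor
    · rintro ⟨-, S, hS, rfl⟩
      obtain ⟨i, c, hE, -⟩ := hS.exists_corner hn
      exact ⟨(i, c), Set.mem_univ _, hzeros hE⟩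
    · rintro ⟨⟨i, c⟩, -, rfl⟩
      obtain ⟨S, hS, -, hE⟩ := exists_typeTwo hn i c
      exact ⟨(isComponent_iff hn _).2 ⟨S, Or.inr hS, hzeros hE⟩, S, hS, hzeros hE⟩
  rw [this, Set.ncard_image_of_injective _ (zeros_adjugate_injective hn), Set.ncard_univ,
    Nat.card_eq_fintype_card, Fintype.card_prod, Fintype.card_fin, sq]

end Counting

/-! ### The unique minor avoiding a set of the second type. -/

section UniqueMinor

variable {n : ℕ}

theorem exists_compl_singleton_of_card {I : Finset (Fin n)} (hn : 1 ≤ n) (hI : I.card = n - 1) :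
    ∃ i, I = {i}ᶜ := by
  have : Iᶜ.card = 1 := by rw [Finset.card_compl, Fintype.card_fin, hI]; omega
  obtain ⟨i, hi⟩ := Finset.card_eq_one.1 this
  exact ⟨i, by rw [← hi, compl_compl]⟩

theorem disjoint_compl_product_iff {S : Finset (Fin n × Fin n)} {i c : Fin n} :
    Disjoint S ({i}ᶜ ×ˢ {c}ᶜ) ↔ ∀ p ∈ S, p.1 = i ∨ p.2 = c := by
  rw [Finset.disjoint_left]
  refine forall₂_congr fun p _ => ?_
  rw [Finset.mem_product, Finset.mem_compl, Finset.mem_compl, Finset.mem_singleton,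
    Finset.mem_singleton]
  tauto

theorem card_compl_singleton (i : Fin n) : ({i}ᶜ : Finset (Fin n)).card = n - 1 := by
  rw [Finset.card_compl, Fintype.card_fin, Finset.card_singleton]

theorem TypeTwo.existsUnique_minor (hn : 2 ≤ n) {S : Finset (Fin n × Fin n)} (hS : TypeTwo S) :
    ∃! IJ : Finset (Fin n) × Finset (Fin n),
      IJ.1.card = n - 1 ∧ IJ.2.card = n - 1 ∧ Disjoint S (IJ.1 ×ˢ IJ.2) := by
  obtain ⟨i, c, -, h⟩ := hS.exists_corner hn
  refine ⟨({i}ᶜ, {c}ᶜ), ⟨card_compl_singleton i, card_compl_singleton c,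
    disjoint_compl_product_iff.2 ((h i c).2 ⟨rfl, rfl⟩)⟩, ?_⟩
  rintro ⟨I, J⟩ ⟨hI, hJ, hIJ⟩
  obtain ⟨i', rfl⟩ := exists_compl_singleton_of_card (by omega) hI
  obtain ⟨c', rfl⟩ := exists_compl_singleton_of_card (by omega) hJ
  obtain ⟨rfl, rfl⟩ := (h i' c').1 (disjoint_compl_product_iff.1 hIJ)
  rfl

theorem TypeTwo.hasEquation_minor (hn : 2 ≤ n) {S : Finset (Fin n × Fin n)} (hS : TypeTwo S)
    {I J : Finset (Fin n)} (hI : I.card = n - 1) (hJ : J.card = n - 1)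
    (hIJ : Disjoint S (I ×ˢ J)) : HasEquation (rigJoin (n - 2) S) (minor I J) := by
  obtain ⟨i, c, hE, h⟩ := hS.exists_corner hn
  obtain ⟨i', rfl⟩ := exists_compl_singleton_of_card (by omega) hI
  obtain ⟨c', rfl⟩ := exists_compl_singleton_of_card (by omega) hJ
  obtain ⟨rfl, rfl⟩ := (h i' c').1 (disjoint_compl_product_iff.1 hIJ)
  exact hE.delMinor_of_adjugate

end UniqueMinor

/-! ### Collinear sets and codimension. -/

section CollinearSets

/-- The pencil of matrices with a zero row `i` and otherwise entries `x` on the diagonal and `y`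
next to it. -/
def rowPencil {m : ℕ} (i : Fin (m + 1)) : ℂ × ℂ →ₗ[ℂ] Mat (m + 1) where
  toFun z := of fun a b => ∑ k : Fin m, if i.succAbove k = a then
    (if b = k.castSucc then z.1 else 0) + (if b = k.succ then z.2 else 0) else 0
  map_add' z w := by
    ext a b
    simp only [of_apply, Matrix.add_apply, ← Finset.sum_add_distrib]
    refine Finset.sum_congr rfl fun k _ => ?_
    split_ifs <;> simp <;> ring
  map_smul' c z := by
    ext a b
    simp only [of_apply, Matrix.smul_apply, smul_eq_mul, Finset.mul_sum, RingHom.id_apply]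
    refine Finset.sum_congr rfl fun k _ => ?_
    split_ifs <;> simp [mul_add]

theorem rowPencil_apply {m : ℕ} (i : Fin (m + 1)) (z : ℂ × ℂ) (k : Fin m) (b : Fin (m + 1)) :
    rowPencil i z (i.succAbove k) b =
      (if b = k.castSucc then z.1 else 0) + (if b = k.succ then z.2 else 0) := by
  simp [rowPencil, Fin.succAbove_right_injective.eq_iff]

/-- Outside row `i` the matrix is bidiagonal. Dropping the last column leaves a triangular matrix
with diagonal `z.1`; if `z.1 = 0`, dropping the first leaves a diagonal matrix with entries `z.2`.
-/
theorem exists_adjugate_rowPencil_ne_zero {m : ℕ} (i : Fin (m + 1)) {z : ℂ × ℂ} (hz : z ≠ 0) :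
    ∃ c, (rowPencil i z).adjugate c i ≠ 0 := by
  by_cases h1 : z.1 = 0
  · have h2 : z.2 ≠ 0 := fun h2 => hz (Prod.ext h1 h2)
    refine ⟨0, ?_⟩
    rw [adjugate_fin_succ_eq_det_submatrix, det_of_isUpperTriangular]
    · refine mul_ne_zero (by simp) (Finset.prod_ne_zero_iff.2 fun k _ => ?_)
      simp [rowPencil_apply, h1, h2]
    · intro k l hkl
      have hkl : l ≠ k := (show l < k from hkl).ne
      simp [rowPencil_apply, h1, hkl]
  · refine ⟨Fin.last m, ?_⟩
    rw [adjugate_fin_succ_eq_det_submatrix, det_of_isUpperTriangular]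
    · refine mul_ne_zero (by simp) (Finset.prod_ne_zero_iff.2 fun k _ => ?_)
      simp [rowPencil_apply, h1, (Fin.castSucc_lt_succ (i := k)).ne]
    · intro k l hkl
      have hkl : l < k := hkl
      have h2 : l.castSucc ≠ k.succ :=
        ((Fin.castSucc_lt_castSucc_iff.2 hkl).trans (Fin.castSucc_lt_succ (i := k))).ne
      simp [rowPencil_apply, hkl.ne, h2]

theorem exists_pencil {n : ℕ} (hn : 2 ≤ n) (i : Fin n) :
    ∃ W : Submodule ℂ (Mat n), Module.finrank ℂ W = 2 ∧
      ∀ M ∈ W, M ≠ 0 → ∃ c, M.adjugate c i ≠ 0 := by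
  obtain ⟨m, rfl⟩ := Nat.exists_eq_add_of_le' hn
  refine ⟨LinearMap.range (rowPencil (m := m + 1) i), ?_, ?_⟩
  · rw [LinearMap.finrank_range_of_inj]
    · simp
    · rw [← LinearMap.ker_eq_bot, LinearMap.ker_eq_bot']
      intro z hz
      by_contra hz0
      obtain ⟨c, hc⟩ := exists_adjugate_rowPencil_ne_zero (m := m + 1) i hz0
      rw [hz] at hc
      exact hc (by simp)
  · rintro _ ⟨z, rfl⟩ hM
    refine exists_adjugate_rowPencil_ne_zero (m := m + 1) i ?_
    rintro rfl
    exact hM (map_zero _)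

theorem not_isHypersurface_of_pencil {n : ℕ} {X : Set (Mat n)} {W : Submodule ℂ (Mat n)}
    (hW : Module.finrank ℂ W = 2) (h : ∀ M ∈ W, M ≠ 0 → M ∉ X) : ¬ IsHypersurface X := by
  rintro ⟨-, hX⟩
  have h1 : codim X ∈ {c : ℕ | ∀ W : Submodule ℂ (Mat n), Module.finrank ℂ W = c + 1 →
      ∃ M ∈ W, M ≠ 0 ∧ M ∈ X} := by
    -- The set defining `codim` is nonempty: `n * n` belongs to it vacuously, as there is no
    -- subspace of dimension `n * n + 1`. So the infimum is an element, not the default `0`.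
    refine Nat.sInf_mem ⟨n * n, fun W hW => ?_⟩
    have := Submodule.finrank_le W
    rw [hW, Module.finrank_matrix] at this
    simp at this
  rw [hX] at h1
  obtain ⟨M, hM, hM0, hMX⟩ := h1 W hW
  exact h M hM hM0 hMX

theorem not_isHypersurface_of_collinear {n : ℕ} (hn : 2 ≤ n) {S : Finset (Fin n × Fin n)}
    (hS : Collinear S) : ¬ IsHypersurface (rigJoin (n - 2) S) := by
  have key : ∀ {i c : Fin n}, (∀ p ∈ S, p.1 = i ∨ p.2 = c) → ∀ {M : Mat n},
      M ∈ rigJoin (n - 2) S → M.adjugate c i = 0 := by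
    intro i c h M hM
    rw [rigJoin_eq] at hM
    have := zariskiClosure_subset (isZariskiClosed_zeros ((genericMat n).adjugate c i))
      (fun N hN => (evalAt_adjugate N c i).trans (adjugate_eq_zero_of_mem_sumSet hn h hN)) hM
    exact (evalAt_adjugate M c i).symm.trans this
  rcases hS with ⟨i, hi⟩ | ⟨j, hj⟩
  · obtain ⟨W, hW, h⟩ := exists_pencil hn i
    refine not_isHypersurface_of_pencil hW fun M hM hM0 hMX => ?_
    obtain ⟨c, hc⟩ := h M hM hM0
    exact hc (key (fun p hp => Or.inl (hi p hp)) hMX)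
  · obtain ⟨W, hW, h⟩ := exists_pencil hn j
    refine not_isHypersurface_of_pencil
      ((LinearEquiv.finrank_map_eq (transposeEquiv n) W).trans hW) ?_
    rintro _ ⟨M, hM, rfl⟩ hM0 hMX
    obtain ⟨c, hc⟩ := h M hM (by rintro rfl; exact hM0 (map_zero _))
    have h1 := key (i := c) (c := j) (fun p hp => Or.inr (hj p hp)) hMX
    apply hc
    change Mᵀ.adjugate j c = 0 at h1
    rwa [← adjugate_transpose, transpose_apply] at h1

end CollinearSets

end Rigidity

end

theorem mainTheorem5 (n : ℕ) (hn : 2 ≤ n) :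
    -- the irreducible components are the joins for `S` of the two types
    (∀ X : Set (Mat n), IsComponent (borderRig n (n - 2) 3) X ↔
      ∃ S : Finset (Fin n × Fin n), (TypeOne S ∨ TypeTwo S) ∧ X = rigJoin (n - 2) S) ∧
    -- up to linear isomorphism there is one variety of each type, and the two types differ
    (∀ S T : Finset (Fin n × Fin n), (TypeOne S ∧ TypeOne T ∨ TypeTwo S ∧ TypeTwo T) →
      LinIso (rigJoin (n - 2) S) (rigJoin (n - 2) T)) ∧
    (∀ S T : Finset (Fin n × Fin n), TypeOne S → TypeTwo T →
      ¬ LinIso (rigJoin (n - 2) S) (rigJoin (n - 2) T)) ∧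
    -- first type: degree, equation for a suitable and for an arbitrary labelling of `S`
    (∀ S : Finset (Fin n × Fin n), TypeOne S →
      IsHypersurfaceOfDegree (rigJoin (n - 2) S) (2 * n - 3) ∧
      ∃ i j : Fin 3 → Fin n, S = entries i j ∧
        HasEquation (rigJoin (n - 2) S) (twoTermEq 1 i j)) ∧
    (∀ i j : Fin 3 → Fin n, Function.Injective i → Function.Injective j →
      HasEquation (rigJoin (n - 2) (entries i j)) (twoTermEq (labelSign i j) i j)) ∧
    -- first type: number of components, and maximality of the degree
    Set.ncard {X : Set (Mat n) | IsComponent (borderRig n (n - 2) 3) X ∧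
      ∃ S : Finset (Fin n × Fin n), TypeOne S ∧ X = rigJoin (n - 2) S} = 6 * (n.choose 3) ^ 2 ∧
    (∀ (X : Set (Mat n)) (d : ℕ), IsComponent (borderRig n (n - 2) 3) X →
      IsHypersurfaceOfDegree X d → d ≤ 2 * n - 3) ∧
    -- second type: the equation is the unique minor of size `n - 1` that avoids `S`
    (∀ S : Finset (Fin n × Fin n), TypeTwo S →
      IsHypersurfaceOfDegree (rigJoin (n - 2) S) (n - 1) ∧
      (∃! IJ : Finset (Fin n) × Finset (Fin n),
        IJ.1.card = n - 1 ∧ IJ.2.card = n - 1 ∧ Disjoint S (IJ.1 ×ˢ IJ.2)) ∧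
      ∀ I J : Finset (Fin n), I.card = n - 1 → J.card = n - 1 → Disjoint S (I ×ˢ J) →
        HasEquation (rigJoin (n - 2) S) (minor I J)) ∧
    Set.ncard {X : Set (Mat n) | IsComponent (borderRig n (n - 2) 3) X ∧
      ∃ S : Finset (Fin n × Fin n), TypeTwo S ∧ X = rigJoin (n - 2) S} = n ^ 2 ∧
    -- collinear entries do not give a hypersurface
    (∀ S : Finset (Fin n × Fin n), S.card = 3 → Collinear S →
      ¬ IsHypersurface (rigJoin (n - 2) S)) := by
  refine ⟨isComponent_iff hn, ?_, fun S T hS hT => not_linIso hS hT, fun S hS => ?_,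
    fun i j hi hj => hasEquation_twoTermEq hi hj, ncard_components_typeOne hn,
    fun X d hX hd => ?_, fun S hS => ⟨isHypersurfaceOfDegree_of_typeTwo hn hS,
      hS.existsUnique_minor hn, fun I J hI hJ hIJ => hS.hasEquation_minor hn hI hJ hIJ⟩,
    ncard_components_typeTwo hn, fun S _ hS => not_isHypersurface_of_collinear hn hS⟩
  · rintro S T (⟨hS, hT⟩ | ⟨hS, hT⟩)
    · exact linIso_of_typeOne hS hT _
    · exact linIso_of_typeTwo hn hS hT
  · refine ⟨isHypersurfaceOfDegree_of_typeOne hS, ?_⟩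
    obtain ⟨i, j, hi, hj, rfl⟩ := typeOne_iff.1 hS
    obtain ⟨e, he⟩ := exists_labelSign_eq_one hi hj
    refine ⟨i ∘ e, j ∘ e, (entries_comp i j e).symm, ?_⟩
    have := hasEquation_twoTermEq (hi.comp e.injective) (hj.comp e.injective)
    rwa [he, entries_comp] at this
  · obtain ⟨S, hS | hS, rfl⟩ := (isComponent_iff hn X).1 hX
    · exact (eq_of_isHypersurfaceOfDegree hd
        (isHypersurfaceOfDegree_of_typeOne hS)).le
    · have := eq_of_isHypersurfaceOfDegree hd
        (isHypersurfaceOfDegree_of_typeTwo hn hS)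
      omega
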